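/- **Setting.** Let $A,B\in\mathbb R^{n\times n}$ be symmetric, $a,b\in\mathbb R^n$, $d\in\mathbb R$, and consider $$\text{(GTRS)}\qquad \min f(x):=x^TAx+2a^Tx\quad\text{s.t.}\quad h(x):=x^TBx+2b^Tx+d\le 0 .$$ *Assumption 1.* Numbers $\rho_A,\rho_B$ with $\|A\|_2\le\rho_A\le3\|A\|_2$, $\|B\|_2\le\rho_B\le 3\|B\|_2$ and $\xi>0$ are given such that $\lambda_{\min}(B)\le-\xi$ and $\mu A+(1-\mu)B\succeq\xi I$ for some $\mu\in(0,1]$. Put $\phi=\rho_A+\rho_B+\|a\|+\|b\|+|d|+1$, $\tilde\xi=\min\{\xi,1\}$, and let $N$ be the total number of nonzero entries of $A$ and $B$. *Oracle.* Running times count arithmetic operations, elementary functions and comparisons on real numbers and fair coin flips. An approximate eigenvector oracle ApproxMinEV takes a symmetric $n\times n$ matrix $C$, $\rho>0$ with $\|C\|_2\le\rho$, $\epsilon>0$ and $\delta\in(0,1)$. With probability at least $1-\delta$ it returns a unit vector $x$ with $x^TCx\le\lambda_{\min}(C)+\epsilon$ and the number $\lambda=x^TCx$. It always runs in time at most $c\,N_C\max\{1,\sqrt{\rho/\epsilon}\}\log(2n/\delta)$,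 where $c$ is a constant and $N_C$ is the maximum of $n$ and the number of nonzero entries of $C$. *PsdPencil*$(A,B,\xi,\phi,\delta)$. Let $T=\lceil\log_2(8\phi/\xi)\rceil$, $\mu_1=0$, $\mu_2=1$. At most $T$ times: let $\mu=(\mu_1+\mu_2)/2$ and call ApproxMinEV on $\mu A+(1-\mu)B$ (norm bound $\phi$, accuracy $\xi/4$, failure probability $\delta/T$), obtaining $(\lambda,x)$; if $\lambda\ge 3\xi/4$ return $(\mu,\lambda,x)$; otherwise set $\mu_1=\mu$ if $x^TAx>x^TBx$, and $\mu_2=\mu$ if not. After $T$ unsuccessful steps, report failure. *Bounds*$(A,B,\xi,a,b,d,\phi,\delta)$. Obtain $(\mu_0,\lambda,x)$ from PsdPencil with failure probability $\delta/2$; put $\bar\lambda=\lambda-\xi/4$, $\nu_0=(1-\mu_0)/\mu_0$, $p=a+\nu_0b$ and $l=d\nu_0-\mu_0\|p\|^2/\bar\lambda$. Call ApproxMinEV on $B$ (norm bound $\phi$, accuracy $\xi/2$, failure probability $\delta/2$), obtaining $(\varpi,y)$. Let $\alpha$ be either root of $\varpi\alpha^2+2(b^Ty)\alpha+d=0$ if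 this equation has a real root, and $\alpha=0$ otherwise; put $u=f(\alpha y)$. Return $(\mu_0,\lambda,l,u)$. **Theorem (Bounds).** An approximate eigenvector oracle exists. Let Bounds use any such oracle, let $0<\delta<1$, and let Assumption 1 hold. Then (GTRS) has a finite optimal value $v^*$, and with probability at least $1-\delta$ Bounds returns $(\mu_0,\lambda,l,u)$ with the following properties. 1. $0<\mu_0\le1$, $\mu_0A+(1-\mu_0)B\succeq\frac{\xi}{2}I$, and $\lambda_{\min}(\mu_0A+(1-\mu_0)B)\le\lambda\le\lambda_{\min}(\mu_0A+(1-\mu_0)B)+\frac{\xi}{4}$. 2. $l\le f(x)+\nu_0h(x)$ for all $x\in\mathbb R^n$, where $\nu_0=(1-\mu_0)/\mu_0$; that is, $l$ is at most the Lagrangian dual function at $\nu_0$. 3. $u=f(\alpha y)$ for some $\alpha\in\mathbb R$ and some unit vector $y$ with $y^TBy\le\lambda_{\min}(B)+\frac{\xi}{2}$ and $h(\alpha y)\le0$. 4. $l\le v^*\le u$ and $$u-l\le K\,\frac{\phi^3}{\tilde\xi^2},$$ where $K$ is an absolute constant. The total running time of Bounds is always at most $$K_1\,\frac{N\sqrt\phi}{\sqrt\xi}\,\log\!\Big(\frac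 n\delta\log\frac{8\phi}{\xi}\Big)\log\frac{8\phi}{\xi},$$ where $K_1$ depends only on the constant $c$ of the oracle. Consequently, for every $\kappa\in\mathbb R$ there is $K_2$, depending only on $c$ and $\kappa$, such that whenever $\xi\le\frac14$ and $\phi\le\xi^{-\kappa}$ (for instance, for $\phi$ bounded), the running time is at most $$K_2\,\frac{N\sqrt\phi}{\sqrt\xi}\,\log\!\Big(\frac n\delta\log\frac1\xi\Big)\log\frac1\xi .$$ -/

import Mathlib

namespace GTRS

noncomputable section

/-! ## Vectors, matrices, the problem -/

/-- `ℝⁿ` with its Euclidean norm. -/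
abbrev Vec (n : ℕ) : Type := EuclideanSpace ℝ (Fin n)

/-- Real `n × n` matrices. -/
abbrev Mat (n : ℕ) : Type := Matrix (Fin n) (Fin n) ℝ

/-- The operator `x ↦ M x` on Euclidean space. -/
def act {n : ℕ} (M : Mat n) : Vec n →L[ℝ] Vec n :=
  Matrix.toEuclideanCLM (n := Fin n) (𝕜 := ℝ) M

/-- The spectral norm `‖M‖₂`. -/
def opNorm {n : ℕ} (M : Mat n) : ℝ := ‖act M‖

/-- The quadratic form `xᵀ M x`. -/
def quad {n : ℕ} (M : Mat n) (x : Vec n) : ℝ := inner ℝ x (act M x)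

/-- The smallest (real) eigenvalue of `M`. -/
def lamMin {n : ℕ} (M : Mat n) : ℝ := sInf (spectrum ℝ M)

/-- The number of nonzero entries of `M`. -/
def nnz {n : ℕ} (M : Mat n) : ℕ := {p : Fin n × Fin n | M p.1 p.2 ≠ 0}.ncard

/-- The matrix `μ A + (1 - μ) B` of the pencil. -/
def pencil {n : ℕ} (A B : Mat n) (μ : ℝ) : Mat n := μ • A + (1 - μ) • B

/-- An instance: the data of the problem
`min xᵀAx + 2aᵀx` subject to `xᵀBx + 2bᵀx + d ≤ 0`,
with the given norm bounds `ρA`, `ρB` and the given parameter `ξ`. -/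
structure Inst (n : ℕ) where
  A : Mat n
  B : Mat n
  a : Vec n
  b : Vec n
  d : ℝ
  ρA : ℝ
  ρB : ℝ
  ξ : ℝ

namespace Inst

variable {n : ℕ} (P : Inst n)

/-- The objective `f(x) = xᵀAx + 2aᵀx`. -/
def f (x : Vec n) : ℝ := quad P.A x + 2 * inner ℝ P.a x

/-- The constraint function `h(x) = xᵀBx + 2bᵀx + d`. -/
def h (x : Vec n) : ℝ := quad P.B x + 2 * inner ℝ P.b x + P.d

/-- `v` is the optimal value: the infimum of `f` over a nonempty feasible set on which `f` is
bounded below (nonemptiness and boundedness follow from `v` being a real greatest lower bound). -/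
def IsOptimalValue (v : ℝ) : Prop := IsGLB (P.f '' {x | P.h x ≤ 0}) v

/-- `φ = ρ_A + ρ_B + ‖a‖ + ‖b‖ + |d| + 1`. -/
def φ : ℝ := P.ρA + P.ρB + ‖P.a‖ + ‖P.b‖ + |P.d| + 1

/-- `ξ̃ = min {ξ, 1}`. -/
def ξt : ℝ := min P.ξ 1

/-- The total number of nonzero entries of `A` and `B`. -/
def N : ℕ := nnz P.A + nnz P.B

/-- The standing assumption, together with the symmetry of `A` and `B`. -/
structure Assumption : Prop where
  symmA : P.A.IsSymm
  symmB : P.B.IsSymm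
  normA : opNorm P.A ≤ P.ρA ∧ P.ρA ≤ 3 * opNorm P.A
  normB : opNorm P.B ≤ P.ρB ∧ P.ρB ≤ 3 * opNorm P.B
  ξ_pos : 0 < P.ξ
  lamMinB : lamMin P.B ≤ -P.ξ
  regular : ∃ μ : ℝ, 0 < μ ∧ μ ≤ 1 ∧ (pencil P.A P.B μ - P.ξ • (1 : Mat n)).PosSemidef

end Inst

/-! ## Randomized algorithms with a step count

A randomized computation with result in `α` is the joint law of its result and of the number of
elementary steps it performed. Elementary steps are operations on real numbers
(`+ - * / √ log`, comparisons, copies) and fair coin flips; matrices are stored sparsely. Programs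
below are composed out of the primitives of this section; each charges its own steps. -/

/-- A randomized computation: the law of the pair (result, number of steps). -/
structure Alg (α : Type) where
  law : PMF (α × ℕ)

namespace Alg

/-- Sequential composition adds up the steps. -/
instance : Monad Alg where
  pure x := ⟨PMF.pure (x, 0)⟩
  bind m g := ⟨m.law.bind fun r => (g r.1).law.map fun s => (s.1, r.2 + s.2)⟩

/-- The probability that the result satisfies `p`. -/
def prob {α : Type} (m : Alg α) (p : α → Prop) : ENNReal :=
  m.law.toOuterMeasure {r | p r.1}

/-- In every run the number of steps is at most `t`. -/
def StepsLE {α : Type} (m : Alg α) (t : ℝ) : Prop :=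
  ∀ r ∈ m.law.support, (r.2 : ℝ) ≤ t

/-- Charge `k` steps. -/
def tick (k : ℕ) : Alg Unit := ⟨PMF.pure ((), k)⟩

end Alg

open Alg

/-- Sparse matrix-vector product. -/
def matVec {n : ℕ} (M : Mat n) (x : Vec n) : Alg (Vec n) := do
  tick (2 * nnz M + n)
  return act M x

/-- Inner product of two vectors. -/
def dot {n : ℕ} (x y : Vec n) : Alg ℝ := do
  tick (2 * n)
  return inner ℝ x y

/-- The combination `s x + t y`. -/
def lin {n : ℕ} (s : ℝ) (x : Vec n) (t : ℝ) (y : Vec n) : Alg (Vec n) := do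
  tick (3 * n)
  return s • x + t • y

/-- The multiple `s x`. -/
def scale {n : ℕ} (s : ℝ) (x : Vec n) : Alg (Vec n) := do
  tick n
  return s • x

/-- The value `xᵀ M x`, by one product with `M` and one inner product. -/
def evalQuad {n : ℕ} (M : Mat n) (x : Vec n) : Alg ℝ := do
  let w ← matVec M x
  dot x w

/-- Forms the sparse matrix `μ A + (1 - μ) B`. -/
def formPencil {n : ℕ} (A B : Mat n) (μ : ℝ) : Alg (Mat n) := do
  tick (3 * (nnz A + nnz B) + 1)
  return pencil A B μ

/-- A vector whose coordinates are independent and uniform on `{0, 1/2^m, …, (2^m - 1)/2^m}`: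
`m` coin flips for each coordinate, and two operations per flip to assemble the binary expansion. -/
def sampleGrid (n m : ℕ) : Alg (Vec n) :=
  ⟨(PMF.uniformOfFintype (Fin n → Fin (2 ^ m))).map fun z =>
    (WithLp.toLp 2 fun i => ((z i : ℕ) : ℝ) / 2 ^ m, 3 * (n * m))⟩

/-! ## Approximate smallest eigenvectors -/

/-- A procedure for approximate smallest eigenpairs; its arguments are a matrix `C`, a bound `ρ` on
its norm, the accuracy `ε` and the failure probability `δ`. -/
abbrev Oracle : Type := (n : ℕ) → Mat n → (ρ ε δ : ℝ) → Alg (ℝ × Vec n)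

/-- The guarantee of an approximate eigenvector oracle, with the constant `c` in its running time:
for symmetric `C` with `‖C‖₂ ≤ ρ`, with probability at least `1 - δ` it returns a unit vector `x`
and `λ = xᵀCx` with `xᵀCx ≤ λ_min(C) + ε`, in time `O(N √(ρ/ε) log(n/δ))`. The `max` and the `2` only
keep the two factors from falling below a positive constant. -/
def IsApproxMinEV (O : Oracle) (c : ℝ) : Prop :=
  ∀ (n : ℕ) (C : Mat n) (ρ ε δ : ℝ), 0 < n → C.IsSymm → 0 < ρ → opNorm C ≤ ρ → 0 < ε →
    0 < δ → δ < 1 →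
    ENNReal.ofReal (1 - δ) ≤
      (O n C ρ ε δ).prob (fun r => ‖r.2‖ = 1 ∧ r.1 = quad C r.2 ∧ quad C r.2 ≤ lamMin C + ε) ∧
    (O n C ρ ε δ).StepsLE
      (c * (max (nnz C) n : ℕ) * max 1 (Real.sqrt (ρ / ε)) * Real.log (2 * n / δ))

/-- `k` steps of the three-term recurrence `w₂ = 2 X w - w₁` with
`X = ((ρ + s) I - 2 C) / (ρ - s)`, starting from the pair `(w₁, w)`; returns the last `w`. The map
`t ↦ (ρ + s - 2 t) / (ρ - s)` takes `[s, ρ]` onto `[-1, 1]`. -/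
def chebIter {n : ℕ} (C : Mat n) (ρ s : ℝ) : ℕ → Vec n → Vec n → Alg (Vec n)
  | 0, _, w => return w
  | k + 1, w1, w => do
      let v ← matVec C w
      tick 7
      let v' ← lin (2 * (ρ + s) / (ρ - s)) w (-(4 / (ρ - s))) v
      let w2 ← lin 1 v' (-1) w1
      chebIter C ρ s k w w2

/-- The number of recurrence steps used at scale `η`. -/
def chebDegree (n : ℕ) (ρ δ η : ℝ) : ℕ :=
  ⌈4 * Real.sqrt (ρ / η) * Real.log (16 * n / δ)⌉₊

/-- The stages of the eigenvector procedure. The current vector `x` with value `θ = xᵀCx` is known up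
to accuracy `η`; the stage filters the random start `g` below the threshold `s = θ - η/2` and keeps
the better one of the two vectors, which is then accurate up to `3η/4`. Finding the number of
recurrence steps by counting up is charged. -/
def chebStages {n : ℕ} (C : Mat n) (ρ δ : ℝ) (g : Vec n) :
    ℕ → ℝ → ℝ → Vec n → Alg (ℝ × Vec n)
  | 0, _, θ, x => return (θ, x)
  | j + 1, η, θ, x => do
      tick (chebDegree n ρ δ η + 12)
      let g' ← scale (-1) g
      let y ← chebIter C ρ (θ - η / 2) (chebDegree n ρ δ η) g' g
      let q ← dot y y
      let x' ← scale (1 / Real.sqrt q) y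
      let θ' ← evalQuad C x'
      if 0 < q ∧ θ' < θ then chebStages C ρ δ g j (3 / 4 * η) θ' x'
      else chebStages C ρ δ g j (3 / 4 * η) θ x

/-- An approximate smallest eigenvector by polynomial filtering of a random vector. -/
def chebMinEV : Oracle := fun n C ρ ε δ => do
  let m := ⌈Real.logb 2 (2 / δ)⌉₊
  let J := ⌈Real.logb (4 / 3) (2 * ρ / ε)⌉₊
  tick (m + J + 10)
  let g ← sampleGrid n m
  let q ← dot g g
  let x ← scale (1 / Real.sqrt q) g
  let θ ← evalQuad C x
  chebStages C ρ δ g J (2 * ρ) θ x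

/-! ## The algorithms PsdPencil and Bounds -/

/-- The loop of PsdPencil: at most `k` bisection steps on the interval `(μ₁, μ₂]`, with accuracy
`ξ/4` and failure probability `δ'` for each call of the eigenvector oracle. -/
def psdLoop (O : Oracle) {n : ℕ} (A B : Mat n) (ξ φ δ' : ℝ) :
    ℕ → ℝ → ℝ → Alg (Option (ℝ × ℝ × Vec n))
  | 0, _, _ => return none
  | k + 1, μ₁, μ₂ => do
      tick 10
      let μ := (μ₁ + μ₂) / 2
      let C ← formPencil A B μ
      let r ← O n C φ (ξ / 4) δ'
      if 3 * ξ / 4 ≤ r.1 then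
        return some (μ, r.1, r.2)
      else do
        let xA ← evalQuad A r.2
        let xB ← evalQuad B r.2
        if xB < xA then psdLoop O A B ξ φ δ' k μ μ₂
        else psdLoop O A B ξ φ δ' k μ₁ μ

/-- The number `⌈log₂ (8φ/ξ)⌉` of bisection steps. -/
def numIter (ξ φ : ℝ) : ℕ := ⌈Real.logb 2 (8 * φ / ξ)⌉₊

/-- PsdPencil; the result `none` is the message that the assumption fails. -/
def psdPencil (O : Oracle) {n : ℕ} (A B : Mat n) (ξ φ δ : ℝ) :
    Alg (Option (ℝ × ℝ × Vec n)) := do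
  tick (numIter ξ φ + 5)
  psdLoop O A B ξ φ (δ / numIter ξ φ) (numIter ξ φ) 0 1

/-- The output of Bounds. -/
structure Output where
  μ₀ : ℝ
  lam : ℝ
  l : ℝ
  u : ℝ

/-- The number `α` for which `α y` is the feasible point, where `ϖ = yᵀBy` and `β = bᵀy`: a root of
`ϖ α² + 2 β α + d = 0` (the choice of the root is a parameter). If there is no real root then `0`
is taken (for `ϖ < 0` the left side is then negative for all `α`). -/
def stepLength (root : Bool) (ϖ β d : ℝ) : ℝ :=
  if 0 ≤ β ^ 2 - ϖ * d then
    (-β + (if root then 1 else -1) * Real.sqrt (β ^ 2 - ϖ * d)) / ϖ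
  else 0

/-- The algorithm Bounds. -/
def bounds (O : Oracle) (root : Bool) {n : ℕ} (P : Inst n) (δ : ℝ) : Alg (Option Output) := do
  let r ← psdPencil O P.A P.B P.ξ P.φ (δ / 2)
  match r with
  | none => return none
  | some (μ₀, lam, _) => do
      tick 50
      let lamBar := lam - P.ξ / 4
      let ν₀ := (1 - μ₀) / μ₀
      let p ← lin 1 P.a ν₀ P.b
      let pp ← dot p p
      let l := P.d * ν₀ - μ₀ * pp / lamBar
      let e ← O n P.B P.φ (P.ξ / 2) (δ / 2)
      let β ← dot P.b e.2
      let z ← scale (stepLength root e.1 β P.d) e.2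
      let zA ← evalQuad P.A z
      let az ← dot P.a z
      return some ⟨μ₀, lam, l, zA + 2 * az⟩

/-- The output of Bounds is correct, with `v` the optimal value and `K` the constant in the bound
on the gap. -/
structure Output.Correct {n : ℕ} (P : Inst n) (v K : ℝ) (o : Output) : Prop where
  /-- `μ₀ ∈ (0, 1]` and `μ₀ A + (1 - μ₀) B ⪰ (ξ/2) I`. -/
  μ_pos : 0 < o.μ₀
  μ_le : o.μ₀ ≤ 1
  psd : (pencil P.A P.B o.μ₀ - (P.ξ / 2) • (1 : Mat n)).PosSemidef
  /-- `lam` approximates the smallest eigenvalue of `μ₀ A + (1 - μ₀) B`. -/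
  lam_ge : lamMin (pencil P.A P.B o.μ₀) ≤ o.lam
  lam_le : o.lam ≤ lamMin (pencil P.A P.B o.μ₀) + P.ξ / 4
  /-- `l` is a lower bound for the Lagrangian dual function at `ν₀ = (1 - μ₀)/μ₀`. -/
  dual : ∀ x : Vec n, o.l ≤ P.f x + (1 - o.μ₀) / o.μ₀ * P.h x
  /-- `u` is the value of `f` at a feasible multiple of an approximate smallest eigenvector. -/
  primal : ∃ (α : ℝ) (y : Vec n), ‖y‖ = 1 ∧ quad P.B y ≤ lamMin P.B + P.ξ / 2 ∧
    P.h (α • y) ≤ 0 ∧ o.u = P.f (α • y)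
  lower : o.l ≤ v
  upper : v ≤ o.u
  gap : o.u - o.l ≤ K * P.φ ^ 3 / P.ξt ^ 2

end

end GTRS

/-!
# Bounds for the generalized trust region subproblem

*The oracle.* Write the random start vector `g` in an orthonormal eigenbasis of `C`. Filtering with
threshold `s` multiplies the coordinate at the eigenvalue `t` by `σ(t)`, a Chebyshev polynomial of
the fourth kind after `[s, ρ]` is mapped to `[-1, 1]`. These polynomials satisfy
`sin (θ/2) σ = sin ((k + 1/2) θ)` at the point `cos θ`, so `(t - s) σ(t)²` is at most `ρ - s` on
`[s, ρ]`, while for the smallest eigenvalue the same identity with `sinh` gives the negative term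
`-(ρ - s) sinh² ((2k + 1) τ)`. Summing over the basis, the Rayleigh quotient of the filtered vector
is at most `s` as soon as `sinh ((2k + 1) τ)` exceeds the ratio of `‖g‖` to the component of `g` along
a smallest eigenvector (`quad_chebVec_le`). The degree is chosen to make this amplification at least
`4 n / δ` (`le_sinh_of_chebDegree`), and with probability `1 - δ` the ratio is at most `4 n / δ`
because one coordinate of the eigenvector is at least `1/√n` (`card_small_inner_le`). Each stage
reduces the accuracy from `η` to `3η/4`, and the costs `√(ρ/η)` of the stages form a geometric sum
(`chebStages_spec`).

*The bisection.* The form `xᵀ(μA + (1 - μ)B)x` is affine in `μ`, so a vector on which it is below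
`3ξ/4` tells on which side the number `μ'` of the regularity assumption lies, and that it lies more
than `ξ/(4φ)` away. The interval can therefore not shrink to length `ξ/(8φ)` without success
(`failLE_psdLoop`).

*The bounds.* The lower bound is weak duality after completing the square (`dual_bound`); the upper
bound is the value at a feasible multiple of an approximate smallest eigenvector of `B`. The gap is
controlled by `μ₀ ≥ ξ/(2φ)` and by the bound `5φ/ξ̃` for the step length (`correct_of_success`).

Probabilities are handled as bounds on the probability of failure (`Alg.FailLE`), which add up under
sequential composition, and every deterministic part of a program is rewritten as a single result
with a step count (`Alg.det`).
-/

namespace GTRS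

noncomputable section

open Alg

/-! ### Failure probabilities and step counts of composed computations -/

namespace Alg

variable {α β : Type}

/-- The computation that returns `a` after exactly `k` steps. -/
def det (a : α) (k : ℕ) : Alg α := ⟨PMF.pure (a, k)⟩

/-- With probability at least `1 - ε` the result satisfies `p`, stated as a bound on the
probability of failure, which adds up under sequential composition. -/
def FailLE (m : Alg α) (p : α → Prop) (ε : ℝ) : Prop :=
  m.prob (fun a => ¬ p a) ≤ ENNReal.ofReal ε

lemma prob_add_prob_not (m : Alg α) (p : α → Prop) :
    m.prob p + m.prob (fun a => ¬ p a) = 1 := by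
  classical
  unfold prob
  rw [PMF.toOuterMeasure_apply, PMF.toOuterMeasure_apply, ← ENNReal.tsum_add, ← m.law.tsum_coe]
  congr 1
  ext r
  by_cases h : p r.1 <;> simp [Set.indicator, h]

lemma failLE_iff {m : Alg α} {p : α → Prop} {ε : ℝ} (hε : 0 ≤ ε) :
    m.FailLE p ε ↔ ENNReal.ofReal (1 - ε) ≤ m.prob p := by
  have h := prob_add_prob_not m p
  have hp : m.prob p ≠ ⊤ := fun h' => by simp [h'] at h
  have hq : m.prob (fun a => ¬ p a) ≠ ⊤ := fun h' => by simp [h'] at h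
  unfold FailLE
  rw [ENNReal.le_ofReal_iff_toReal_le hq hε, ENNReal.ofReal_le_iff_le_toReal hp]
  have := congrArg ENNReal.toReal h
  rw [ENNReal.toReal_add hp hq, ENNReal.toReal_one] at this
  constructor <;> intro h <;> linarith

lemma bind_law (m : Alg α) (g : α → Alg β) :
    (m >>= g).law = m.law.bind fun r => (g r.1).law.map fun s => (s.1, r.2 + s.2) := rfl

lemma prob_bind (m : Alg α) (g : α → Alg β) (p : β → Prop) :
    (m >>= g).prob p = ∑' r, m.law r * (g r.1).prob p := by
  unfold prob
  rw [bind_law, PMF.toOuterMeasure_bind_apply]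
  congr 1
  ext r
  rw [PMF.toOuterMeasure_map_apply]
  rfl

lemma prob_le_one (m : Alg α) (p : α → Prop) : m.prob p ≤ 1 :=
  (prob_add_prob_not m p).symm ▸ le_self_add

/-- The union bound for a sequential composition. -/
lemma FailLE.bind {m : Alg α} {g : α → Alg β} {p : α → Prop} {q : β → Prop} {ε₁ ε₂ : ℝ}
    (h₁ : m.FailLE p ε₁) (hε₁ : 0 ≤ ε₁) (hε₂ : 0 ≤ ε₂) (h₂ : ∀ a, p a → (g a).FailLE q ε₂) :
    (m >>= g).FailLE q (ε₁ + ε₂) := by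
  classical
  unfold FailLE
  rw [prob_bind, ENNReal.ofReal_add hε₁ hε₂]
  calc ∑' r, m.law r * (g r.1).prob (fun a => ¬ q a)
      ≤ ∑' r, ({r : α × ℕ | ¬ p r.1}.indicator m.law r + m.law r * ENNReal.ofReal ε₂) := by
        refine ENNReal.tsum_le_tsum fun r => ?_
        by_cases h : p r.1
        · exact le_add_left (mul_le_mul_right (h₂ _ h) _)
        · refine le_add_right ?_
          rw [Set.indicator_of_mem (by exact h)]
          exact mul_le_of_le_one_right' (prob_le_one _ _)
    _ = m.prob (fun a => ¬ p a) + ENNReal.ofReal ε₂ := by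
        rw [ENNReal.tsum_add, ENNReal.tsum_mul_right, m.law.tsum_coe, one_mul, prob,
          PMF.toOuterMeasure_apply]
    _ ≤ _ := by gcongr; exact h₁

lemma FailLE.bind_sure {m : Alg α} {g : α → Alg β} {p : α → Prop} {q : β → Prop} {ε : ℝ}
    (h₁ : m.FailLE p ε) (hε : 0 ≤ ε) (h₂ : ∀ a, p a → (g a).FailLE q 0) :
    (m >>= g).FailLE q ε := by
  simpa using h₁.bind hε le_rfl h₂

lemma failLE_det {a : α} {k : ℕ} {p : α → Prop} {ε : ℝ} (h : p a) : (det a k).FailLE p ε := by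
  unfold FailLE prob det
  rw [PMF.toOuterMeasure_pure_apply, if_neg (by simpa using h)]
  exact zero_le

lemma failLE_pure {a : α} {p : α → Prop} {ε : ℝ} (h : p a) :
    (pure a : Alg α).FailLE p ε := failLE_det (k := 0) h

lemma prob_det_bind (a : α) (k : ℕ) (g : α → Alg β) (p : β → Prop) :
    (det a k >>= g).prob p = (g a).prob p := by
  unfold prob det
  rw [bind_law, PMF.pure_bind, PMF.toOuterMeasure_map_apply]
  rfl

lemma failLE_det_bind {a : α} {k : ℕ} {g : α → Alg β} {p : β → Prop} {ε : ℝ} :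
    (det a k >>= g).FailLE p ε ↔ (g a).FailLE p ε := by
  unfold FailLE; rw [prob_det_bind]

lemma StepsLE.mono {m : Alg α} {s t : ℝ} (h : m.StepsLE s) (hst : s ≤ t) : m.StepsLE t :=
  fun r hr => (h r hr).trans hst

lemma stepsLE_det {a : α} {k : ℕ} {t : ℝ} (h : (k : ℝ) ≤ t) : (det a k).StepsLE t := by
  intro r hr
  have : r = (a, k) := by simpa [det] using hr
  subst this
  exact h

lemma stepsLE_pure {a : α} {t : ℝ} (h : 0 ≤ t) : (pure a : Alg α).StepsLE t :=
  stepsLE_det (k := 0) (by simpa using h)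

lemma StepsLE.bind {m : Alg α} {g : α → Alg β} {s t : ℝ} (h₁ : m.StepsLE s)
    (h₂ : ∀ a, (g a).StepsLE t) : (m >>= g).StepsLE (s + t) := by
  intro r hr
  rw [bind_law, PMF.mem_support_bind_iff] at hr
  obtain ⟨r₁, hr₁, hr⟩ := hr
  rw [PMF.mem_support_map_iff] at hr
  obtain ⟨r₂, hr₂, rfl⟩ := hr
  push_cast
  exact add_le_add (h₁ _ hr₁) (h₂ _ _ hr₂)

lemma stepsLE_det_bind {a : α} {k : ℕ} {g : α → Alg β} {t : ℝ}
    (h : (g a).StepsLE (t - k)) : (det a k >>= g).StepsLE t := by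
  intro r hr
  rw [bind_law, det, PMF.pure_bind, PMF.mem_support_map_iff] at hr
  obtain ⟨r₂, hr₂, rfl⟩ := hr
  have := h _ hr₂
  push_cast
  linarith

lemma det_bind_eq_det {a : α} {k l : ℕ} {b : β} {g : α → Alg β} (h : g a = det b l) :
    (det a k >>= g) = det b (k + l) := by
  show Alg.mk _ = Alg.mk _
  congr 1
  simp [det, PMF.pure_bind, h, PMF.pure_map]

lemma pure_eq_det (a : α) : (pure a : Alg α) = det a 0 := rfl

lemma tick_eq_det (k : ℕ) : tick k = det () k := rfl

lemma tick_bind_pure (k : ℕ) (a : α) : (tick k >>= fun _ => (pure a : Alg α)) = det a k := by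
  rw [tick_eq_det, pure_eq_det]; exact det_bind_eq_det (l := 0) (b := a) rfl

end Alg

section Primitives

variable {n : ℕ}

lemma matVec_eq (M : Mat n) (x : Vec n) : matVec M x = det (act M x) (2 * nnz M + n) :=
  tick_bind_pure _ _

lemma dot_eq (x y : Vec n) : dot x y = det (inner ℝ x y) (2 * n) := tick_bind_pure _ _

lemma lin_eq (s : ℝ) (x : Vec n) (t : ℝ) (y : Vec n) :
    lin s x t y = det (s • x + t • y) (3 * n) := tick_bind_pure _ _

lemma scale_eq (s : ℝ) (x : Vec n) : scale s x = det (s • x) n := tick_bind_pure _ _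

lemma evalQuad_eq (M : Mat n) (x : Vec n) :
    evalQuad M x = det (quad M x) (2 * nnz M + 3 * n) := by
  unfold evalQuad
  rw [matVec_eq, det_bind_eq_det (dot_eq _ _)]
  congr 1
  ring

lemma formPencil_eq (A B : Mat n) (μ : ℝ) :
    formPencil A B μ = det (pencil A B μ) (3 * (nnz A + nnz B) + 1) := tick_bind_pure _ _

end Primitives

/-! ### Quadratic forms, the smallest eigenvalue, and sparsity -/

variable {n : ℕ}

lemma quad_eq_dotProduct (M : Mat n) (x : Vec n) :
    quad M x = x.ofLp ⬝ᵥ M.mulVec x.ofLp := by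
  unfold quad act
  rw [EuclideanSpace.inner_eq_star_dotProduct, Matrix.ofLp_toEuclideanCLM]
  simp [dotProduct_comm]

lemma act_add (M N : Mat n) : act (M + N) = act M + act N := map_add _ _ _

lemma act_smul (c : ℝ) (M : Mat n) : act (c • M) = c • act M := map_smul _ _ _

lemma act_one : act (1 : Mat n) = 1 := map_one _

lemma quad_smul_vec (M : Mat n) (c : ℝ) (x : Vec n) : quad M (c • x) = c ^ 2 * quad M x := by
  simp only [quad, map_smul, inner_smul_left, inner_smul_right]
  simp; ring

lemma quad_pencil (A B : Mat n) (μ : ℝ) (x : Vec n) :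
    quad (pencil A B μ) x = μ * quad A x + (1 - μ) * quad B x := by
  simp [quad, pencil, act_add, act_smul, inner_add_right, inner_smul_right]

lemma quad_sub_smul_one (M : Mat n) (c : ℝ) (x : Vec n) :
    quad (M - c • (1 : Mat n)) x = quad M x - c * ‖x‖ ^ 2 := by
  simp [quad, sub_eq_add_neg, ← neg_smul, act_add, act_smul, act_one, inner_add_right,
    inner_smul_right]

lemma abs_quad_le (M : Mat n) (x : Vec n) : |quad M x| ≤ opNorm M * ‖x‖ ^ 2 := by
  calc |quad M x| ≤ ‖x‖ * ‖act M x‖ := abs_real_inner_le_norm _ _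
    _ ≤ ‖x‖ * (‖act M‖ * ‖x‖) := by gcongr; exact (act M).le_opNorm x
    _ = opNorm M * ‖x‖ ^ 2 := by unfold opNorm; ring

lemma opNorm_nonneg (M : Mat n) : 0 ≤ opNorm M := norm_nonneg _

lemma isHermitian_of_isSymm {M : Mat n} (h : M.IsSymm) : M.IsHermitian := by
  rw [Matrix.IsHermitian, Matrix.conjTranspose_eq_transpose_of_trivial]; exact h

lemma isSymm_pencil {A B : Mat n} (hA : A.IsSymm) (hB : B.IsSymm) (μ : ℝ) :
    (pencil A B μ).IsSymm := (hA.smul _).add (hB.smul _)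

/-- `M - c I ⪰ 0` in terms of the quadratic form. -/
lemma posSemidef_sub_smul_one_iff {M : Mat n} (hM : M.IsSymm) (c : ℝ) :
    (M - c • (1 : Mat n)).PosSemidef ↔ ∀ x : Vec n, c * ‖x‖ ^ 2 ≤ quad M x := by
  have key : ∀ x : Vec n, star x.ofLp ⬝ᵥ (M - c • (1 : Mat n)).mulVec x.ofLp
      = quad M x - c * ‖x‖ ^ 2 := fun x => by
    rw [← quad_sub_smul_one, quad_eq_dotProduct]; rfl
  constructor
  · intro h x
    have := h.dotProduct_mulVec_nonneg x.ofLp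
    rw [key] at this
    linarith
  · intro h
    refine Matrix.PosSemidef.of_dotProduct_mulVec_nonneg ?_ fun x => ?_
    · exact isHermitian_of_isSymm (hM.sub (Matrix.isSymm_one.smul c))
    · have := key (WithLp.toLp 2 x)
      rw [this]
      linarith [h (WithLp.toLp 2 x)]

/-- The spectral theorem, with the smallest eigenvalue singled out. -/
lemma exists_eigenbasis {M : Mat n} (hn : 0 < n) (hM : M.IsSymm) :
    ∃ (b : OrthonormalBasis (Fin n) ℝ (Vec n)) (e : Fin n → ℝ) (i₀ : Fin n),
      (∀ i, act M (b i) = e i • b i) ∧ e i₀ = lamMin M ∧ ∀ i, e i₀ ≤ e i := by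
  have hH := isHermitian_of_isSymm hM
  have : Nonempty (Fin n) := ⟨⟨0, hn⟩⟩
  obtain ⟨i₀, hi₀⟩ := Finite.exists_min hH.eigenvalues
  refine ⟨hH.eigenvectorBasis, hH.eigenvalues, i₀, fun i => ?_, ?_, hi₀⟩
  · apply (WithLp.equiv 2 _).injective
    show (act M _).ofLp = _
    unfold act
    rw [Matrix.ofLp_toEuclideanCLM, hH.mulVec_eigenvectorBasis]
    rfl
  · rw [lamMin, hH.spectrum_real_eq_range_eigenvalues]
    have h : IsLeast (Set.range hH.eigenvalues) (hH.eigenvalues i₀) :=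
      ⟨⟨i₀, rfl⟩, by rintro _ ⟨i, rfl⟩; exact hi₀ i⟩
    exact h.csInf_eq.symm

lemma inner_act_eigenvector {M : Mat n} {b : OrthonormalBasis (Fin n) ℝ (Vec n)} {e : Fin n → ℝ}
    (hb : ∀ i, act M (b i) = e i • b i) (i : Fin n) (x : Vec n) :
    inner ℝ (b i) (act M x) = e i * inner ℝ (b i) x := by
  conv_lhs => rw [← b.sum_repr' x, map_sum]
  simp [hb, inner_sum, inner_smul_right, b.inner_eq_ite, mul_comm]

/-- In an orthonormal eigenbasis the quadratic form is diagonal. -/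
lemma quad_eq_sum {M : Mat n} {b : OrthonormalBasis (Fin n) ℝ (Vec n)} {e : Fin n → ℝ}
    (hb : ∀ i, act M (b i) = e i • b i) (x : Vec n) :
    quad M x = ∑ i, e i * (inner ℝ (b i) x) ^ 2 := by
  rw [quad, ← b.sum_inner_mul_inner]
  refine Finset.sum_congr rfl fun i _ => ?_
  rw [inner_act_eigenvector hb, real_inner_comm x (b i)]
  ring

lemma norm_sq_eq_sum (b : OrthonormalBasis (Fin n) ℝ (Vec n)) (x : Vec n) :
    ‖x‖ ^ 2 = ∑ i, (inner ℝ (b i) x) ^ 2 := by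
  rw [← b.sum_sq_norm_inner_right x]
  simp

lemma lamMin_mul_norm_sq_le {M : Mat n} (hn : 0 < n) (hM : M.IsSymm) (x : Vec n) :
    lamMin M * ‖x‖ ^ 2 ≤ quad M x := by
  obtain ⟨b, e, i₀, hb, h₀, hmin⟩ := exists_eigenbasis hn hM
  rw [quad_eq_sum hb, norm_sq_eq_sum b, Finset.mul_sum, ← h₀]
  exact Finset.sum_le_sum fun i _ => mul_le_mul_of_nonneg_right (hmin i) (sq_nonneg _)

lemma lamMin_le_quad {M : Mat n} (hn : 0 < n) (hM : M.IsSymm) {x : Vec n} (hx : ‖x‖ = 1) :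
    lamMin M ≤ quad M x := by
  simpa [hx] using lamMin_mul_norm_sq_le hn hM x

lemma quad_eigenvector {M : Mat n} {x : Vec n} {e : ℝ} (h : act M x = e • x) (hx : ‖x‖ = 1) :
    quad M x = e := by
  rw [quad, h, inner_smul_right, real_inner_self_eq_norm_sq, hx]; simp

lemma exists_quad_eq_lamMin {M : Mat n} (hn : 0 < n) (hM : M.IsSymm) :
    ∃ x : Vec n, ‖x‖ = 1 ∧ quad M x = lamMin M := by
  obtain ⟨b, e, i₀, hb, h₀, -⟩ := exists_eigenbasis hn hM
  exact ⟨b i₀, b.orthonormal.1 _, by rw [← h₀, quad_eigenvector (hb i₀) (b.orthonormal.1 _)]⟩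

lemma abs_lamMin_le {M : Mat n} (hn : 0 < n) (hM : M.IsSymm) : |lamMin M| ≤ opNorm M := by
  obtain ⟨x, hx, h⟩ := exists_quad_eq_lamMin hn hM
  simpa [hx, h] using abs_quad_le M x

lemma opNorm_pencil_le (A B : Mat n) {μ : ℝ} (h0 : 0 ≤ μ) (h1 : μ ≤ 1) :
    opNorm (pencil A B μ) ≤ opNorm A + opNorm B := by
  unfold opNorm pencil
  rw [act_add, act_smul, act_smul]
  refine (norm_add_le _ _).trans ?_
  rw [norm_smul, norm_smul, Real.norm_of_nonneg h0, Real.norm_of_nonneg (by linarith)]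
  have := norm_nonneg (act A)
  have := norm_nonneg (act B)
  gcongr <;> nlinarith

lemma nnz_pencil_le (A B : Mat n) (μ : ℝ) : nnz (pencil A B μ) ≤ nnz A + nnz B := by
  unfold nnz
  refine le_trans (Set.ncard_le_ncard ?_ (Set.toFinite _)) (Set.ncard_union_le _ _)
  intro p hp
  by_contra h
  simp only [Set.mem_union, Set.mem_ofPred_eq, not_or, not_not] at h
  exact hp (by simp [pencil, h.1, h.2])

/-- A matrix with no zero on its diagonal has at least `n` nonzero entries. -/
lemma le_nnz_of_diag_ne_zero {M : Mat n} (h : ∀ i, M i i ≠ 0) : n ≤ nnz M := by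
  unfold nnz
  calc n = (Set.range fun i : Fin n => (i, i)).ncard := by
        rw [Set.ncard_eq_toFinset_card', Set.toFinset_range, Finset.card_image_of_injective]
        · simp
        · intro i j hij; exact (Prod.mk.inj hij).1
    _ ≤ _ := by
        refine Set.ncard_le_ncard ?_ (Set.toFinite _)
        rintro _ ⟨i, rfl⟩
        exact h i

lemma quad_single (M : Mat n) (i : Fin n) : quad M (EuclideanSpace.single i 1) = M i i := by
  rw [quad_eq_dotProduct]
  simp

/-! ### The Chebyshev filter -/

/-- The `k`-th term after `c` of the recurrence `w₂ = 2 x w - w₁` started from the pair `(a, c)`.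
For `(a, c) = (-1, 1)` this is the Chebyshev polynomial of the fourth kind. -/
def chebRec (x : ℝ) : ℕ → ℝ → ℝ → ℝ
  | 0, _, c => c
  | k + 1, a, c => chebRec x k c (2 * x * c - a)

lemma mul_chebRec (x r : ℝ) (k : ℕ) (a c : ℝ) :
    r * chebRec x k a c = chebRec x k (r * a) (r * c) := by
  induction k generalizing a c with
  | zero => rfl
  | succ k ih => rw [chebRec, chebRec, ih]; ring_nf

lemma chebRec_cos (θ : ℝ) (k : ℕ) (φ : ℝ) :
    chebRec (Real.cos θ) k (Real.sin (φ - θ)) (Real.sin φ) = Real.sin (φ + k * θ) := by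
  induction k generalizing φ with
  | zero => simp [chebRec]
  | succ k ih =>
    have h := ih (φ + θ)
    rw [add_sub_cancel_right] at h
    rw [chebRec]
    convert h using 2
    · rw [Real.sin_sub, Real.sin_add]; ring
    · push_cast; ring

lemma chebRec_cosh (t : ℝ) (k : ℕ) (φ : ℝ) :
    chebRec (Real.cosh t) k (Real.sinh (φ - t)) (Real.sinh φ) = Real.sinh (φ + k * t) := by
  induction k generalizing φ with
  | zero => simp [chebRec]
  | succ k ih =>
    have h := ih (φ + t)
    rw [add_sub_cancel_right] at h
    rw [chebRec]
    convert h using 2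
    · rw [Real.sinh_sub, Real.sinh_add]; ring
    · push_cast; ring

/-- On `[-1, 1]` the filter polynomial is at most `√(2 / (1 - x))` in modulus. -/
lemma one_sub_mul_chebRec_sq_le {x : ℝ} (h₁ : -1 ≤ x) (h₂ : x ≤ 1) (k : ℕ) (g : ℝ) :
    (1 - x) * chebRec x k (-g) g ^ 2 ≤ 2 * g ^ 2 := by
  set θ := Real.arccos x with hθ
  have hx : Real.cos θ = x := Real.cos_arccos h₁ h₂
  have h := mul_chebRec x (Real.sin (θ / 2)) k (-g) g
  have e : chebRec x k (Real.sin (θ / 2) * -g) (Real.sin (θ / 2) * g)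
      = g * Real.sin (θ / 2 + k * θ) := by
    rw [← chebRec_cos, hx, mul_chebRec]
    congr 1
    · rw [show θ / 2 - θ = -(θ / 2) by ring, Real.sin_neg]; ring
    · ring
  have hs : 1 - x = 2 * Real.sin (θ / 2) ^ 2 := by
    rw [Real.sin_sq_eq_half_sub, show 2 * (θ / 2) = θ by ring, hx]; ring
  calc (1 - x) * chebRec x k (-g) g ^ 2
      = 2 * (Real.sin (θ / 2) * chebRec x k (-g) g) ^ 2 := by rw [hs]; ring
    _ = 2 * g ^ 2 * Real.sin (θ / 2 + k * θ) ^ 2 := by rw [h, e]; ring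
    _ ≤ 2 * g ^ 2 * 1 := by gcongr; exact Real.sin_sq_le_one _
    _ = 2 * g ^ 2 := mul_one _

/-- Beyond `1` the filter polynomial grows like a hyperbolic sine. -/
lemma sub_one_mul_chebRec_sq (τ : ℝ) (k : ℕ) (g : ℝ) :
    Real.sinh τ ^ 2 * chebRec (1 + 2 * Real.sinh τ ^ 2) k (-g) g ^ 2
      = g ^ 2 * Real.sinh ((2 * k + 1) * τ) ^ 2 := by
  have hx : Real.cosh (2 * τ) = 1 + 2 * Real.sinh τ ^ 2 := by
    rw [Real.cosh_two_mul, Real.cosh_sq]; ring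
  have h := mul_chebRec (1 + 2 * Real.sinh τ ^ 2) (Real.sinh τ) k (-g) g
  have e : chebRec (1 + 2 * Real.sinh τ ^ 2) k (Real.sinh τ * -g) (Real.sinh τ * g)
      = g * Real.sinh ((2 * k + 1) * τ) := by
    rw [show (2 * k + 1) * τ = τ + k * (2 * τ) by ring, ← chebRec_cosh, hx, mul_chebRec]
    congr 1
    · rw [show τ - 2 * τ = -τ by ring, Real.sinh_neg]; ring
    · ring
  rw [← mul_pow, h, e, mul_pow]

/-- The vector returned by `chebIter`. -/
def chebVec {n : ℕ} (C : Mat n) (ρ s : ℝ) : ℕ → Vec n → Vec n → Vec n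
  | 0, _, w => w
  | k + 1, w₁, w => chebVec C ρ s k w
      ((1 : ℝ) • ((2 * (ρ + s) / (ρ - s)) • w + (-(4 / (ρ - s))) • act C w) + (-1 : ℝ) • w₁)

lemma chebIter_eq (C : Mat n) (ρ s : ℝ) (k : ℕ) (w₁ w : Vec n) :
    chebIter C ρ s k w₁ w = det (chebVec C ρ s k w₁ w) (k * (2 * nnz C + 7 * n + 7)) := by
  induction k generalizing w₁ w with
  | zero => simp [chebIter, chebVec, pure_eq_det]
  | succ k ih =>
    rw [chebIter, matVec_eq, det_bind_eq_det]
    rotate_left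
    · rw [tick_eq_det, det_bind_eq_det]
      rw [lin_eq, det_bind_eq_det]
      rw [lin_eq, det_bind_eq_det]
      exact ih _ _
    rw [chebVec]
    congr 1
    ring

/-- In an eigenbasis, filtering acts on each coordinate by the scalar recurrence. -/
lemma inner_chebVec {C : Mat n} {b : OrthonormalBasis (Fin n) ℝ (Vec n)} {e : Fin n → ℝ}
    (hb : ∀ i, act C (b i) = e i • b i) (i : Fin n) (ρ s : ℝ) (k : ℕ) (w₁ w : Vec n) :
    inner ℝ (b i) (chebVec C ρ s k w₁ w)
      = chebRec ((ρ + s - 2 * e i) / (ρ - s)) k (inner ℝ (b i) w₁) (inner ℝ (b i) w) := by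
  induction k generalizing w₁ w with
  | zero => rfl
  | succ k ih =>
    rw [chebVec, chebRec, ih]
    congr 1
    simp only [inner_add_right, inner_smul_right, inner_act_eigenvector hb]
    ring

/-- The filter with threshold `s` produces a vector of Rayleigh quotient at most `s` as soon as the
amplification of the smallest eigendirection makes up for its share in the start vector: with
`σᵢ` the value of the filter at the eigenvalue `eᵢ`, the terms `(eᵢ - s) σᵢ²` are at most `ρ - s`
for all `i`, and the term of the smallest eigenvalue is `-(ρ - s) sinh² ((2k + 1) τ)`. -/
lemma quad_chebVec_le {C : Mat n} {b : OrthonormalBasis (Fin n) ℝ (Vec n)} {e : Fin n → ℝ}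
    (hb : ∀ i, act C (b i) = e i • b i) {i₀ : Fin n} {ρ s τ : ℝ} {k : ℕ} {g : Vec n}
    (he : ∀ i, e i ≤ ρ) (hs : s < ρ) (hτ : 0 < τ)
    (hτs : Real.sinh τ ^ 2 = (s - e i₀) / (ρ - s)) (hg : inner ℝ (b i₀) g ≠ 0)
    (hk : ‖g‖ ≤ Real.sinh ((2 * k + 1) * τ) * |inner ℝ (b i₀) g|) :
    chebVec C ρ s k ((-1 : ℝ) • g) g ≠ 0 ∧
    quad C (chebVec C ρ s k ((-1 : ℝ) • g) g) ≤ s * ‖chebVec C ρ s k ((-1 : ℝ) • g) g‖ ^ 2 := by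
  set y := chebVec C ρ s k ((-1 : ℝ) • g) g with hy
  have hρs : 0 < ρ - s := by linarith
  have hc : ∀ i, inner ℝ (b i) y
      = chebRec ((ρ + s - 2 * e i) / (ρ - s)) k (-inner ℝ (b i) g) (inner ℝ (b i) g) := fun i => by
    rw [hy, inner_chebVec hb, inner_smul_right]; simp
  have h₀ : (s - e i₀) * inner ℝ (b i₀) y ^ 2
      = (ρ - s) * (inner ℝ (b i₀) g ^ 2 * Real.sinh ((2 * k + 1) * τ) ^ 2) := by
    rw [← sub_one_mul_chebRec_sq, hc]
    have : (ρ + s - 2 * e i₀) / (ρ - s) = 1 + 2 * Real.sinh τ ^ 2 := by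
      rw [hτs]; field_simp; ring
    rw [this, ← mul_assoc, hτs, mul_div_cancel₀ _ hρs.ne']
  have hsinh : 0 < Real.sinh ((2 * k + 1) * τ) := Real.sinh_pos_iff.2 (by positivity)
  constructor
  · intro h
    have hpos : 0 < (ρ - s) * (inner ℝ (b i₀) g ^ 2 * Real.sinh ((2 * k + 1) * τ) ^ 2) := by
      positivity
    rw [← h₀, h] at hpos
    simp at hpos
  · have hterm : ∀ i, (e i - s) * inner ℝ (b i) y ^ 2 ≤ (ρ - s) * inner ℝ (b i) g ^ 2 := by
      intro i
      rcases le_or_gt s (e i) with hi | hi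
      · have hx : 1 - (ρ + s - 2 * e i) / (ρ - s) = 2 * (e i - s) / (ρ - s) := by
          field_simp; ring
        have := one_sub_mul_chebRec_sq_le (x := (ρ + s - 2 * e i) / (ρ - s))
          (by rw [le_div_iff₀ hρs]; linarith [he i]) (by rw [div_le_one hρs]; linarith) k
          (inner ℝ (b i) g)
        rw [← hc, hx] at this
        have h2 := mul_le_mul_of_nonneg_left this hρs.le
        rw [← mul_assoc, mul_div_cancel₀ _ hρs.ne'] at h2
        linarith
      · refine le_trans (mul_nonpos_of_nonpos_of_nonneg (by linarith) (sq_nonneg _)) ?_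
        positivity
    have hsum : quad C y - s * ‖y‖ ^ 2 = ∑ i, (e i - s) * inner ℝ (b i) y ^ 2 := by
      rw [quad_eq_sum hb, norm_sq_eq_sum b, Finset.mul_sum, ← Finset.sum_sub_distrib]
      exact Finset.sum_congr rfl fun i _ => by ring
    have hle : ∑ i, (e i - s) * inner ℝ (b i) y ^ 2
        ≤ (ρ - s) * ‖g‖ ^ 2 + (e i₀ - s) * inner ℝ (b i₀) y ^ 2 := by
      rw [norm_sq_eq_sum b g, Finset.mul_sum, ← Finset.sum_erase_add _ _ (Finset.mem_univ i₀)]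
      gcongr
      refine (Finset.sum_le_sum fun i _ => hterm i).trans
        (Finset.sum_le_sum_of_subset_of_nonneg (Finset.erase_subset _ _) fun i _ _ => ?_)
      positivity
    have hk2 : ‖g‖ ^ 2 ≤ inner ℝ (b i₀) g ^ 2 * Real.sinh ((2 * k + 1) * τ) ^ 2 := by
      calc ‖g‖ ^ 2 ≤ (Real.sinh ((2 * k + 1) * τ) * |inner ℝ (b i₀) g|) ^ 2 := by gcongr
        _ = _ := by rw [mul_pow, sq_abs]; ring
    have := mul_le_mul_of_nonneg_left hk2 hρs.le
    linarith

/-- The number of recurrence steps is large enough for the amplification `4 n / δ`. -/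
lemma le_sinh_of_chebDegree {n : ℕ} (hn : 0 < n) {ρ δ η D E τ : ℝ} (hδ : 0 < δ)
    (hδ1 : δ < 1) (hη : 0 < η) (hηρ : η ≤ 2 * ρ) (hD : η / 4 ≤ D) (hE : 0 < E)
    (hEρ : E ≤ 2 * ρ) (hτ : Real.sinh τ = √(D / E)) :
    4 * n / δ ≤ Real.sinh ((2 * chebDegree n ρ δ η + 1) * τ) := by
  have hρ : 0 < ρ := by linarith
  have hn1 : (1 : ℝ) ≤ n := by exact_mod_cast hn
  have hX : 16 ≤ 16 * n / δ := by rw [le_div_iff₀ hδ]; nlinarith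
  set L := Real.log (16 * n / δ) with hL
  have hL0 : 0 ≤ L := Real.log_nonneg (by linarith)
  set r := √(ρ / η) with hr
  have hr0 : 0 < r := Real.sqrt_pos.2 (by positivity)
  have hr2 : r ^ 2 = ρ / η := Real.sq_sqrt (by positivity)
  -- `z = √(η/ρ)/8` is a lower bound for `τ`
  set z := 1 / (8 * r) with hz
  have hz0 : 0 < z := by positivity
  have hr_ge : 1 / 2 ≤ r := by
    refine Real.le_sqrt_of_sq_le ?_
    rw [le_div_iff₀ hη]; linarith
  have hz1 : z ≤ 1 / 4 := by
    rw [hz, div_le_div_iff₀ (by positivity) (by norm_num)]; linarith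
  have hsz : Real.sinh z ≤ 2 * z := by
    have h1 := (abs_le.1 (Real.abs_exp_sub_one_sub_id_le (x := z)
      (by rw [abs_of_pos hz0]; linarith))).2
    have h2 := Real.add_one_le_exp (-z)
    rw [Real.sinh_eq]
    nlinarith
  have hDE : (2 * z) ^ 2 ≤ D / E := by
    have h1 : (2 * z) ^ 2 = η / (16 * ρ) := by
      rw [hz, show (2 * (1 / (8 * r))) ^ 2 = 1 / (16 * r ^ 2) by field_simp; ring, hr2]
      field_simp
    rw [h1, div_le_div_iff₀ (by positivity) hE]
    nlinarith
  have hzτ : z ≤ τ := by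
    rw [← Real.sinh_le_sinh, hτ]
    exact hsz.trans (Real.le_sqrt_of_sq_le hDE)
  have hk : 4 * r * L ≤ chebDegree n ρ δ η := Nat.le_ceil _
  have hLu : L ≤ (2 * chebDegree n ρ δ η + 1) * τ := by
    have h1 : L = (2 * (4 * r * L)) * z := by rw [hz]; field_simp; ring
    rw [h1]
    have : 0 ≤ 4 * r * L := by positivity
    gcongr
    linarith
  refine le_trans ?_ (Real.sinh_le_sinh.2 hLu)
  rw [Real.sinh_eq, hL, Real.exp_neg, Real.exp_log (by linarith)]
  have h1 : (16 * n / δ)⁻¹ ≤ 1 := inv_le_one_of_one_le₀ (by linarith)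
  have h2 : 4 * (n : ℝ) / δ = (16 * n / δ) / 4 := by ring
  rw [h2]
  linarith

/-! ### The stages of the eigenvector procedure -/

/-- What is required of the result `(λ, x)` of the eigenvector procedure at accuracy `ε`. -/
def IsApproxPair (C : Mat n) (ε : ℝ) (r : ℝ × Vec n) : Prop :=
  ‖r.2‖ = 1 ∧ r.1 = quad C r.2 ∧ quad C r.2 ≤ lamMin C + ε

/-- A start vector is good if its component along some unit eigenvector of the smallest eigenvalue
is not too small. -/
def GoodStart (C : Mat n) (δ : ℝ) (g : Vec n) : Prop :=
  ∃ (b : OrthonormalBasis (Fin n) ℝ (Vec n)) (e : Fin n → ℝ) (i₀ : Fin n),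
    (∀ i, act C (b i) = e i • b i) ∧ e i₀ = lamMin C ∧
    inner ℝ (b i₀) g ≠ 0 ∧ ‖g‖ ≤ 4 * n / δ * |inner ℝ (b i₀) g|

lemma norm_normalize {y : Vec n} (hy : y ≠ 0) :
    ‖(1 / √(inner ℝ y y)) • y‖ = 1 := by
  rw [← norm_eq_sqrt_real_inner, norm_smul, Real.norm_of_nonneg (by positivity)]
  exact one_div_mul_cancel (norm_ne_zero_iff.2 hy)

lemma quad_normalize (C : Mat n) (y : Vec n) :
    quad C ((1 / √(inner ℝ y y)) • y) = quad C y / ‖y‖ ^ 2 := by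
  rw [← norm_eq_sqrt_real_inner, quad_smul_vec]; ring

/-- One stage: if the current value exceeds the smallest eigenvalue by more than `3η/4`, then the
filtered start vector has Rayleigh quotient at most `λ_min + η/2`. -/
lemma quad_filtered_le {C : Mat n} (hn : 0 < n) {ρ δ η θ : ℝ} {g : Vec n}
    (hCρ : opNorm C ≤ ρ) (hδ : 0 < δ) (hδ1 : δ < 1) (hη : 0 < η) (hηρ : η ≤ 2 * ρ)
    (hg : GoodStart C δ g) (hθρ : θ ≤ ρ) (hθ : θ ≤ lamMin C + η)
    (hθ' : lamMin C + 3 / 4 * η < θ) :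
    chebVec C ρ (θ - η / 2) (chebDegree n ρ δ η) ((-1 : ℝ) • g) g ≠ 0 ∧
    quad C (chebVec C ρ (θ - η / 2) (chebDegree n ρ δ η) ((-1 : ℝ) • g) g)
      ≤ (lamMin C + η / 2) *
        ‖chebVec C ρ (θ - η / 2) (chebDegree n ρ δ η) ((-1 : ℝ) • g) g‖ ^ 2 := by
  obtain ⟨b, e, i₀, hb, h₀, hg0, hgn⟩ := hg
  have he : ∀ i, |e i| ≤ ρ := fun i => by
    have h := abs_quad_le C (b i)
    rw [quad_eigenvector (hb i) (b.orthonormal.1 i), b.orthonormal.1 i] at h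
    linarith
  have he₀ := (abs_le.1 (he i₀)).1
  have hD : η / 4 ≤ θ - η / 2 - e i₀ := by linarith
  have hE : 0 < ρ - (θ - η / 2) := by linarith
  have hDE : 0 < (θ - η / 2 - e i₀) / (ρ - (θ - η / 2)) := div_pos (by linarith) hE
  set τ := Real.arsinh √((θ - η / 2 - e i₀) / (ρ - (θ - η / 2))) with hτ
  have hτ0 : 0 < τ := Real.arsinh_pos_iff.2 (Real.sqrt_pos.2 hDE)
  have hsτ : Real.sinh τ = √((θ - η / 2 - e i₀) / (ρ - (θ - η / 2))) := Real.sinh_arsinh _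
  have hk := le_sinh_of_chebDegree hn hδ hδ1 hη hηρ hD hE (by linarith) hsτ
  have := quad_chebVec_le (ρ := ρ) (s := θ - η / 2) hb (fun i => (abs_le.1 (he i)).2) (by linarith) hτ0
    (by rw [hsτ, Real.sq_sqrt hDE.le]) hg0
    (hgn.trans (mul_le_mul_of_nonneg_right hk (abs_nonneg _)))
  refine ⟨this.1, this.2.trans ?_⟩
  gcongr
  linarith

/-- All stages together: the result, and the step count as a geometric sum with ratio `√(4/3)`. -/
lemma chebStages_spec (hn : 0 < n) (C : Mat n) {ρ δ : ℝ} (g : Vec n) (hρ : 0 < ρ)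
    (hCρ : opNorm C ≤ ρ) (hδ : 0 < δ) (hδ1 : δ < 1) (j : ℕ) (η θ : ℝ) (x : Vec n) (hη : 0 < η) :
    ∃ (r : ℝ × Vec n) (N : ℕ), chebStages C ρ δ g j η θ x = det r N ∧
      (N : ℝ) ≤ (max (nnz C) n : ℕ) * (476 * Real.log (16 * n / δ) * √(ρ / η) * (√(4 / 3) ^ j - 1)
        + 38 * j) ∧
      (GoodStart C δ g → η ≤ 2 * ρ → IsApproxPair C η (θ, x) →
        IsApproxPair C ((3 / 4) ^ j * η) r) := by
  induction j generalizing η θ x with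
  | zero =>
    refine ⟨(θ, x), 0, rfl, by simp, fun _ _ h => by simpa using h⟩
  | succ j ih =>
    set k := chebDegree n ρ δ η with hk
    set y := chebVec C ρ (θ - η / 2) k ((-1 : ℝ) • g) g with hy
    set q : ℝ := inner ℝ y y with hq
    set x' := (1 / √q) • y with hx'
    set s := √(4 / 3 : ℝ) with hs
    have hL0 : 0 ≤ Real.log (16 * n / δ) := by
      refine Real.log_nonneg ?_
      have hn1 : (1 : ℝ) ≤ n := by exact_mod_cast hn
      rw [le_div_iff₀ hδ]; nlinarith
    obtain ⟨r₁, N₁, hr₁, hN₁, hc₁⟩ := ih (3 / 4 * η) (quad C x') x' (by positivity)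
    obtain ⟨r₂, N₂, hr₂, hN₂, hc₂⟩ := ih (3 / 4 * η) θ x (by positivity)
    have hstep : ∀ N' : ℕ, (N' : ℝ) ≤ (max (nnz C) n : ℕ) *
          (476 * Real.log (16 * n / δ) * √(ρ / (3 / 4 * η)) * (s ^ j - 1) + 38 * j) →
        ((k + 12 + (n + (k * (2 * nnz C + 7 * n + 7) + (2 * n + (n + ((2 * nnz C + 3 * n) + N')))))
          : ℕ) : ℝ) ≤ (max (nnz C) n : ℕ) *
          (476 * Real.log (16 * n / δ) * √(ρ / η) * (s ^ (j + 1) - 1) + 38 * (j + 1 : ℕ)) := by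
      intro N' hN'
      have hsq : √(ρ / (3 / 4 * η)) = s * √(ρ / η) := by
        rw [hs, ← Real.sqrt_mul (by norm_num)]
        congr 1
        field_simp
      rw [hsq] at hN'
      have hk' : (k : ℝ) ≤ 4 * √(ρ / η) * Real.log (16 * n / δ) + 1 :=
        (Nat.ceil_lt_add_one (by positivity)).le
      generalize hM : max (nnz C) n = M at *
      have hM1 : (1 : ℝ) ≤ M := by
        have : 1 ≤ M := by omega
        exact_mod_cast this
      have hnM : (n : ℝ) ≤ M := by
        have : n ≤ M := by omega
        exact_mod_cast this
      have hzM : (nnz C : ℝ) ≤ M := by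
        have : nnz C ≤ M := by omega
        exact_mod_cast this
      have hs87 : 8 / 7 ≤ s := Real.le_sqrt_of_sq_le (by norm_num)
      have hW : 0 ≤ √(ρ / η) * Real.log (16 * n / δ) := by positivity
      generalize √(ρ / η) = R at *
      generalize Real.log (16 * n / δ) = L at *
      have hk0 : (0 : ℝ) ≤ k := by positivity
      push_cast
      have e1 : (k : ℝ) * (2 * nnz C + 7 * n + 7) ≤ k * (16 * M) := by gcongr; linarith
      have e2 : (k : ℝ) ≤ k * M := le_mul_of_one_le_right hk0 hM1
      have e3 : (k : ℝ) * M ≤ (4 * R * L + 1) * M := by gcongr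
      have e4 : 0 ≤ (R * L * M) * (s - 8 / 7) := by
        refine mul_nonneg (mul_nonneg hW (by linarith)) (by linarith)
      have e5 : (M : ℝ) * (476 * L * R * (s ^ (j + 1) - 1) + 38 * (j + 1))
          = M * (476 * L * (s * R) * (s ^ j - 1) + 38 * j) + 476 * (R * L * M) * (s - 1) + 38 * M := by
        ring
      rw [e5]
      have e6 : 476 * (R * L * M) * (s - 1) = 476 * ((R * L * M) * (s - 8 / 7)) + 68 * (R * L * M) := by
        ring
      rw [e6]
      linarith
    have hdet : ∃ r N', (r = r₁ ∧ N' = N₁ ∧ 0 < q ∧ quad C x' < θ ∨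
          r = r₂ ∧ N' = N₂ ∧ ¬ (0 < q ∧ quad C x' < θ)) ∧
        chebStages C ρ δ g (j + 1) η θ x = det r (k + 12 + (n + (k * (2 * nnz C + 7 * n + 7) +
          (2 * n + (n + ((2 * nnz C + 3 * n) + N')))))) := by
      by_cases hcond : 0 < q ∧ quad C x' < θ
      · refine ⟨r₁, N₁, Or.inl ⟨rfl, rfl, hcond⟩, ?_⟩
        rw [chebStages, tick_eq_det]
        refine det_bind_eq_det ?_
        rw [scale_eq]; refine det_bind_eq_det ?_
        rw [chebIter_eq]; refine det_bind_eq_det ?_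
        rw [dot_eq]; refine det_bind_eq_det ?_
        rw [scale_eq]; refine det_bind_eq_det ?_
        rw [evalQuad_eq]; refine det_bind_eq_det ?_
        rw [if_pos hcond]
        exact hr₁
      · refine ⟨r₂, N₂, Or.inr ⟨rfl, rfl, hcond⟩, ?_⟩
        rw [chebStages, tick_eq_det]
        refine det_bind_eq_det ?_
        rw [scale_eq]; refine det_bind_eq_det ?_
        rw [chebIter_eq]; refine det_bind_eq_det ?_
        rw [dot_eq]; refine det_bind_eq_det ?_
        rw [scale_eq]; refine det_bind_eq_det ?_
        rw [evalQuad_eq]; refine det_bind_eq_det ?_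
        rw [if_neg hcond]
        exact hr₂
    obtain ⟨r, N', hcase, hdet⟩ := hdet
    refine ⟨r, _, hdet, ?_, ?_⟩
    · apply hstep
      rcases hcase with ⟨-, rfl, -⟩ | ⟨-, rfl, -⟩ <;> assumption
    · intro hg hηρ ⟨hx1, hxθ, hxη⟩
      simp only at hx1 hxθ hxη
      rw [← hxθ] at hxη
      have hθρ : θ ≤ ρ := by
        have := (abs_le.1 (abs_quad_le C x)).2
        rw [hx1, ← hxθ] at this
        linarith
      have hfil : lamMin C + 3 / 4 * η < θ →
          0 < q ∧ quad C x' ≤ lamMin C + η / 2 := fun hlt => by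
        obtain ⟨hy0, hyq⟩ := quad_filtered_le hn hCρ hδ hδ1 hη hηρ hg hθρ hxη hlt
        refine ⟨real_inner_self_pos.2 hy0, ?_⟩
        rw [hx', hq, quad_normalize]
        exact (div_le_iff₀ (by positivity)).2 hyq
      rw [show (3 / 4 : ℝ) ^ (j + 1) * η = (3 / 4) ^ j * (3 / 4 * η) by ring]
      rcases hcase with ⟨rfl, -, hq0, hlt⟩ | ⟨rfl, -, hnot⟩
      · refine hc₁ hg (by linarith) ⟨?_, rfl, ?_⟩
        · exact norm_normalize (real_inner_self_pos.1 hq0)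
        · show quad C x' ≤ _
          by_cases h : lamMin C + 3 / 4 * η < θ
          · linarith [(hfil h).2]
          · linarith
      · refine hc₂ hg (by linarith) ⟨hx1, hxθ, ?_⟩
        show quad C x ≤ _
        rw [← hxθ]
        by_contra h
        rw [not_le] at h
        exact hnot ⟨(hfil h).1, by linarith [(hfil h).2]⟩

/-! ### Anticoncentration of the random start vector -/

/-- The grid point with numerators `z`. -/
def gridPoint {m : ℕ} (z : Fin n → Fin (2 ^ m)) : Vec n :=
  WithLp.toLp 2 fun i => ((z i : ℕ) : ℝ) / 2 ^ m

lemma norm_gridPoint_le {m : ℕ} (z : Fin n → Fin (2 ^ m)) : ‖gridPoint z‖ ≤ √n := by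
  rw [EuclideanSpace.norm_eq]
  refine Real.sqrt_le_sqrt ?_
  calc ∑ i, ‖(gridPoint z) i‖ ^ 2 ≤ ∑ _i : Fin n, (1 : ℝ) := by
        refine Finset.sum_le_sum fun i _ => ?_
        rw [gridPoint, Real.norm_of_nonneg (by positivity)]
        refine pow_le_one₀ (by positivity) ?_
        rw [div_le_one (by positivity)]
        have h : ((z i : ℕ) : ℝ) ≤ ((2 ^ m : ℕ) : ℝ) := Nat.cast_le.2 (z i).2.le
        rwa [Nat.cast_pow, Nat.cast_ofNat] at h
    _ = n := by simp

lemma exists_coord_large (hn : 0 < n) {v : Vec n} (hv : ‖v‖ = 1) : ∃ i, 1 / √n ≤ |v i| := by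
  by_contra! h
  have hn' : (0 : ℝ) < n := by exact_mod_cast hn
  have h1 : ‖v‖ ^ 2 = ∑ i, |v i| ^ 2 := by
    rw [EuclideanSpace.norm_sq_eq]; rfl
  have h2 : ∑ i, |v i| ^ 2 < ∑ _i : Fin n, (1 / √(n : ℝ)) ^ 2 := by
    refine Finset.sum_lt_sum_of_nonempty ⟨⟨0, hn⟩, Finset.mem_univ _⟩ fun i _ => ?_
    exact pow_lt_pow_left₀ (h i) (abs_nonneg _) two_ne_zero
  rw [← h1, hv] at h2
  simp [Real.sq_sqrt hn'.le, hn'.ne'] at h2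

lemma card_le_of_dist_le (T : Finset ℕ) (l : ℕ) (h : ∀ a ∈ T, ∀ b ∈ T, b ≤ a + l) :
    T.card ≤ l + 1 := by
  rcases T.eq_empty_or_nonempty with rfl | hT
  · simp
  · calc T.card ≤ (Finset.Icc (T.min' hT) (T.min' hT + l)).card :=
          Finset.card_le_card fun b hb =>
            Finset.mem_Icc.2 ⟨T.min'_le b hb, h _ (T.min'_mem hT) _ hb⟩
      _ = l + 1 := by simp; omega

/-- The coordinate of a random grid point along a unit vector `v` is rarely small: fix all
coordinates but one for which `|vᵢ| ≥ 1/√n`; the remaining one is confined to an interval. -/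
lemma card_small_inner_le (hn : 0 < n) {v : Vec n} (hv : ‖v‖ = 1) {m : ℕ} {δ : ℝ} (hδ : 0 < δ)
    (hm : 2 / δ ≤ 2 ^ m) (S : Finset (Fin n → Fin (2 ^ m)))
    (hS : ∀ z ∈ S, |inner ℝ v (gridPoint z)| ≤ δ / (4 * √n)) :
    (S.card : ℝ) ≤ δ * ((2 ^ m) ^ n : ℕ) := by
  classical
  obtain ⟨i, hi⟩ := exists_coord_large hn hv
  have hn' : (0 : ℝ) < √n := Real.sqrt_pos.2 (by exact_mod_cast hn)
  set M : ℝ := 2 ^ m with hM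
  have hM0 : 0 < M := by positivity
  let f : (Fin n → Fin (2 ^ m)) → ({j // j ≠ i} → Fin (2 ^ m)) := fun z j => z j
  set l := ⌊δ * M / 2⌋₊ with hl
  have hfib : ∀ a ∈ S.image f, (S.filter fun z => f z = a).card ≤ l + 1 := by
    intro a _
    have hinj : Set.InjOn (fun z : Fin n → Fin (2 ^ m) => (z i : ℕ))
        (S.filter fun z => f z = a) := by
      intro z hz z' hz' h
      rw [Finset.mem_coe, Finset.mem_filter] at hz hz'
      ext j
      by_cases hj : j = i
      · rw [hj]; exact h
      · exact congrArg Fin.val (congrFun (hz.2.trans hz'.2.symm) ⟨j, hj⟩)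
    rw [← Finset.card_image_of_injOn hinj]
    refine card_le_of_dist_le _ _ ?_
    simp only [Finset.mem_image, Finset.mem_filter, forall_exists_index, and_imp]
    rintro _ z hz hza rfl _ z' hz' hza' rfl
    have hdiff : inner ℝ v (gridPoint z') - inner ℝ v (gridPoint z)
        = v i * (((z' i : ℕ) : ℝ) - (z i : ℕ)) / M := by
      rw [← inner_sub_right, PiLp.inner_apply, Finset.sum_eq_single i]
      · simp [gridPoint, hM]; ring
      · intro j _ hj
        have : z' j = z j := congrFun (hza'.trans hza.symm) ⟨j, hj⟩
        simp [gridPoint, this]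
      · simp
    have h1 : |v i * (((z' i : ℕ) : ℝ) - (z i : ℕ)) / M| ≤ δ / (2 * √n) := by
      rw [← hdiff]
      refine (abs_sub _ _).trans ((add_le_add (hS z' hz') (hS z hz)).trans_eq ?_)
      field_simp; norm_num
    rw [abs_div, abs_mul, abs_of_pos hM0, div_le_iff₀ hM0] at h1
    have h2 : 1 / √n * |((z' i : ℕ) : ℝ) - (z i : ℕ)| ≤ δ / (2 * √n) * M :=
      (mul_le_mul_of_nonneg_right hi (abs_nonneg _)).trans h1
    have h3 : |((z' i : ℕ) : ℝ) - (z i : ℕ)| ≤ δ * M / 2 := by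
      have := mul_le_mul_of_nonneg_left h2 hn'.le
      field_simp at this
      linarith
    by_contra! hlt
    have h4 : ((l + 1 : ℕ) : ℝ) ≤ ((z' i : ℕ) : ℝ) - (z i : ℕ) := by
      rw [le_sub_iff_add_le]; exact_mod_cast (by omega : l + 1 + (z i : ℕ) ≤ (z' i : ℕ))
    have h5 := Nat.lt_floor_add_one (δ * M / 2)
    have h6 := le_abs_self (((z' i : ℕ) : ℝ) - (z i : ℕ))
    push_cast at h4
    linarith
  have hcard := Finset.card_le_mul_card_image S (l + 1) hfib
  have himg : (S.image f).card ≤ (2 ^ m) ^ (n - 1) := by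
    refine (Finset.card_le_univ _).trans_eq ?_
    simp [Fintype.card_subtype_compl]
  have hl' : ((l + 1 : ℕ) : ℝ) ≤ δ * M := by
    have h1 : (l : ℝ) ≤ δ * M / 2 := Nat.floor_le (by positivity)
    have h2 : 1 ≤ δ * M / 2 := by
      rw [div_le_iff₀ hδ] at hm; linarith
    push_cast
    linarith
  calc (S.card : ℝ) ≤ ((l + 1 : ℕ) : ℝ) * ((2 ^ m) ^ (n - 1) : ℕ) := by
        exact_mod_cast hcard.trans (Nat.mul_le_mul_left _ himg)
    _ ≤ δ * M * ((2 ^ m) ^ (n - 1) : ℕ) := by gcongr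
    _ = δ * ((2 ^ m) ^ n : ℕ) := by
        obtain ⟨k, rfl⟩ : ∃ k, n = k + 1 := ⟨n - 1, by omega⟩
        rw [hM, Nat.add_sub_cancel]; push_cast; ring

lemma stepsLE_sampleGrid (n m : ℕ) : (sampleGrid n m).StepsLE (3 * n * m) := by
  intro r hr
  rw [sampleGrid, PMF.mem_support_map_iff] at hr
  obtain ⟨z, -, rfl⟩ := hr
  push_cast
  linarith

lemma failLE_sampleGrid (hn : 0 < n) {v : Vec n} (hv : ‖v‖ = 1) {m : ℕ} {δ : ℝ} (hδ : 0 < δ)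
    (hm : 2 / δ ≤ 2 ^ m) :
    (sampleGrid n m).FailLE
      (fun g => inner ℝ v g ≠ 0 ∧ ‖g‖ ≤ 4 * n / δ * |inner ℝ v g|) δ := by
  classical
  have hn' : (0 : ℝ) < n := by exact_mod_cast hn
  have hsn : (0 : ℝ) < √n := Real.sqrt_pos.2 hn'
  set p : Vec n → Prop := fun g => inner ℝ v g ≠ 0 ∧ ‖g‖ ≤ 4 * n / δ * |inner ℝ v g| with hp
  have hbad : ∀ z : Fin n → Fin (2 ^ m), ¬ p (gridPoint z) →
      |inner ℝ v (gridPoint z)| ≤ δ / (4 * √n) := by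
    intro z hz
    by_contra! hlt
    refine hz ⟨?_, ?_⟩
    · exact abs_pos.1 (lt_trans (by positivity) hlt)
    · refine (norm_gridPoint_le z).trans ?_
      calc √n = 4 * n / δ * (δ / (4 * √n)) := by
            field_simp; exact Real.sq_sqrt hn'.le
        _ ≤ _ := by gcongr
  have hlaw : (sampleGrid n m).prob (fun g => ¬ p g) =
      (PMF.uniformOfFintype (Fin n → Fin (2 ^ m))).toOuterMeasure
        {z | ¬ p (gridPoint z)} := by
    rw [Alg.prob, sampleGrid, PMF.toOuterMeasure_map_apply]; rfl
  unfold FailLE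
  rw [hlaw, PMF.toOuterMeasure_uniformOfFintype_apply]
  refine ENNReal.div_le_of_le_mul ?_
  have h := card_small_inner_le hn hv hδ hm
    (Finset.univ.filter fun z : Fin n → Fin (2 ^ m) => ¬ p (gridPoint z))
    (fun z hz => hbad z (Finset.mem_filter.1 hz).2)
  rw [← Fintype.card_subtype] at h
  have hc : (Fintype.card (Fin n → Fin (2 ^ m))) = (2 ^ m) ^ n := by simp
  rw [hc, ← ENNReal.ofReal_natCast, ← ENNReal.ofReal_natCast, ← ENNReal.ofReal_mul hδ.le]
  refine ENNReal.ofReal_le_ofReal (le_trans (le_of_eq ?_) h)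
  congr 1

/-! ### The eigenvector procedure is an oracle -/

lemma le_pow_ceil_logb {b y : ℝ} (hb : 1 < b) (hy : 0 < y) : y ≤ b ^ ⌈Real.logb b y⌉₊ := by
  rw [← Real.rpow_natCast, ← Real.logb_le_iff_le_rpow hb hy]
  exact Nat.le_ceil _

lemma pow_ceil_logb_le {b y : ℝ} (hb : 1 < b) (hy : 0 < y) :
    b ^ ⌈Real.logb b y⌉₊ ≤ max 1 (b * y) := by
  rcases le_or_gt y 1 with h | h
  · rw [Nat.ceil_eq_zero.2 (Real.logb_nonpos hb hy.le h), pow_zero]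
    exact le_max_left _ _
  · refine le_trans ?_ (le_max_right _ _)
    have h1 := (Nat.ceil_lt_add_one (Real.logb_nonneg hb h.le)).le
    rw [← Real.rpow_natCast]
    calc b ^ ((⌈Real.logb b y⌉₊ : ℕ) : ℝ) ≤ b ^ (Real.logb b y + 1) :=
          Real.rpow_le_rpow_of_exponent_le hb.le h1
      _ = b * y := by
          rw [Real.rpow_add (by linarith), Real.rpow_logb (by linarith) hb.ne' hy, Real.rpow_one]
          ring

lemma failLE_chebMinEV (hn : 0 < n) {C : Mat n} (hC : C.IsSymm) {ρ ε δ : ℝ} (hρ : 0 < ρ)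
    (hCρ : opNorm C ≤ ρ) (hε : 0 < ε) (hδ : 0 < δ) (hδ1 : δ < 1) :
    (chebMinEV n C ρ ε δ).FailLE (IsApproxPair C ε) δ := by
  obtain ⟨b, e, i₀, hb, h₀, -⟩ := exists_eigenbasis hn hC
  unfold chebMinEV
  dsimp only
  rw [tick_eq_det]
  refine failLE_det_bind.2 ?_
  refine FailLE.bind_sure (failLE_sampleGrid hn (b.orthonormal.1 i₀) hδ
    (by simpa using le_pow_ceil_logb one_lt_two (by positivity : 0 < 2 / δ))) hδ.le ?_
  intro g hg
  rw [dot_eq]; refine failLE_det_bind.2 ?_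
  rw [scale_eq]; refine failLE_det_bind.2 ?_
  rw [evalQuad_eq]; refine failLE_det_bind.2 ?_
  obtain ⟨r, N, hr, -, hc⟩ := chebStages_spec hn C g hρ hCρ hδ hδ1
    ⌈Real.logb (4 / 3) (2 * ρ / ε)⌉₊ (2 * ρ) (quad C ((1 / √(inner ℝ g g)) • g))
    ((1 / √(inner ℝ g g)) • g) (by positivity)
  rw [hr]
  refine failLE_det ?_
  have hg0 : g ≠ 0 := by rintro rfl; exact hg.1 (inner_zero_right _)
  have hx := norm_normalize hg0
  have hres := hc ⟨b, e, i₀, hb, h₀, hg.1, hg.2⟩ le_rfl ⟨hx, rfl, by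
    have h1 := (abs_le.1 (abs_quad_le C ((1 / √(inner ℝ g g)) • g))).2
    have h2 := (abs_le.1 (abs_lamMin_le hn hC)).1
    rw [hx] at h1
    show quad C _ ≤ _
    linarith⟩
  refine ⟨hres.1, hres.2.1, hres.2.2.trans ?_⟩
  have hJ := le_pow_ceil_logb (by norm_num : (1 : ℝ) < 4 / 3) (by positivity : 0 < 2 * ρ / ε)
  rw [div_le_iff₀ hε] at hJ
  have h34 : (3 / 4 : ℝ) ^ ⌈Real.logb (4 / 3) (2 * ρ / ε)⌉₊ *
      (4 / 3) ^ ⌈Real.logb (4 / 3) (2 * ρ / ε)⌉₊ = 1 := by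
    rw [← mul_pow]; norm_num
  have := mul_le_mul_of_nonneg_left hJ
    (by positivity : (0 : ℝ) ≤ (3 / 4) ^ ⌈Real.logb (4 / 3) (2 * ρ / ε)⌉₊)
  rw [← mul_assoc _ _ ε, h34, one_mul] at this
  linarith

lemma log_two_le_log {n : ℕ} (hn : 0 < n) {δ : ℝ} (hδ : 0 < δ) (hδ1 : δ < 1) :
    Real.log 2 ≤ Real.log (2 * n / δ) := by
  have hn1 : (1 : ℝ) ≤ n := by exact_mod_cast hn
  refine Real.log_le_log (by norm_num) ?_
  rw [le_div_iff₀ hδ]; nlinarith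

lemma stepsLE_chebMinEV (hn : 0 < n) {C : Mat n} {ρ ε δ : ℝ} (hρ : 0 < ρ)
    (hCρ : opNorm C ≤ ρ) (hε : 0 < ε) (hδ : 0 < δ) (hδ1 : δ < 1) :
    (chebMinEV n C ρ ε δ).StepsLE
      (6000 * (max (nnz C) n : ℕ) * max 1 √(ρ / ε) * Real.log (2 * n / δ)) := by
  have hn1 : (1 : ℝ) ≤ n := by exact_mod_cast hn
  set ℓ := Real.log (2 * n / δ) with hℓ
  set m := ⌈Real.logb 2 (2 / δ)⌉₊ with hm
  set J := ⌈Real.logb (4 / 3) (2 * ρ / ε)⌉₊ with hJ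
  set Z := max 1 √(ρ / ε) with hZ
  have hlog2 := Real.log_two_gt_d9
  have hℓ2 : Real.log 2 ≤ ℓ := log_two_le_log hn hδ hδ1
  have hZ1 : 1 ≤ Z := le_max_left _ _
  have hmle : (m : ℝ) ≤ 4 * ℓ := by
    have hδ2 : 1 ≤ 2 / δ := by rw [le_div_iff₀ hδ]; linarith
    have h1 := (Nat.ceil_lt_add_one (Real.logb_nonneg one_lt_two hδ2)).le
    have h2 : Real.log (2 / δ) ≤ ℓ := by
      refine Real.log_le_log (by linarith) ?_
      gcongr; linarith
    have h3 : Real.logb 2 (2 / δ) ≤ 2 * ℓ := by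
      rw [Real.logb, div_le_iff₀ (by linarith)]
      nlinarith
    linarith
  have hL : Real.log (16 * n / δ) ≤ 4 * ℓ := by
    have h1 : (16 * n / δ) = 2 ^ 3 * (2 * n / δ) := by ring
    rw [h1, Real.log_mul (by norm_num) (by positivity), Real.log_pow]
    push_cast
    linarith
  have hL0 : 0 ≤ Real.log (16 * n / δ) := by
    refine Real.log_nonneg ?_
    rw [le_div_iff₀ hδ]; nlinarith
  have hQ : √(4 / 3 : ℝ) ^ J ≤ 2 * Z := by
    have h1 : (√(4 / 3 : ℝ) ^ J) ^ 2 = (4 / 3) ^ J := by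
      rw [← pow_mul, mul_comm, pow_mul, Real.sq_sqrt (by norm_num)]
    have h2 := pow_ceil_logb_le (by norm_num : (1 : ℝ) < 4 / 3) (by positivity : 0 < 2 * ρ / ε)
    have h3 : ρ / ε ≤ Z ^ 2 := by
      rw [← Real.sq_sqrt (by positivity : 0 ≤ ρ / ε)]
      gcongr
      exact le_max_right _ _
    refine (sq_le_sq₀ (by positivity) (by positivity)).1 ?_
    rw [h1]
    refine h2.trans (max_le ?_ ?_)
    · nlinarith
    · have : 4 / 3 * (2 * ρ / ε) = 8 / 3 * (ρ / ε) := by ring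
      rw [this]
      nlinarith [sq_nonneg Z]
  have hs87 : 8 / 7 ≤ √(4 / 3 : ℝ) := Real.le_sqrt_of_sq_le (by norm_num)
  have hJle : (J : ℝ) ≤ 14 * Z := by
    have h1 := one_add_mul_sub_le_pow (by linarith : (-1 : ℝ) ≤ √(4 / 3)) J
    have h2 : (J : ℝ) * (1 / 7) ≤ J * (√(4 / 3) - 1) := by gcongr; linarith
    linarith
  unfold chebMinEV
  dsimp only
  rw [← hm, ← hJ]
  rw [tick_eq_det]
  refine stepsLE_det_bind ?_
  refine ((stepsLE_sampleGrid n m).bind (fun g => ?_) (t := 5 * n + 2 * nnz C + n +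
    (max (nnz C) n : ℕ) * (476 * Real.log (16 * n / δ) * √(ρ / (2 * ρ)) * (√(4 / 3) ^ J - 1)
        + 38 * J))).mono ?_
  · rw [dot_eq]; refine stepsLE_det_bind ?_
    rw [scale_eq]; refine stepsLE_det_bind ?_
    rw [evalQuad_eq]; refine stepsLE_det_bind ?_
    obtain ⟨r, N, hr, hN, -⟩ := chebStages_spec hn C g hρ hCρ hδ hδ1 J (2 * ρ)
      (quad C ((1 / √(inner ℝ g g)) • g)) ((1 / √(inner ℝ g g)) • g) (by positivity)
    rw [hr]
    refine stepsLE_det (hN.trans ?_)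
    push_cast
    linarith
  · have hhalf : √(ρ / (2 * ρ)) ≤ 1 := by
      rw [Real.sqrt_le_one, div_le_one (by positivity)]; linarith
    have hq1 : 0 ≤ √(4 / 3 : ℝ) ^ J - 1 := by
      have := one_le_pow₀ (by linarith : (1 : ℝ) ≤ √(4 / 3)) (n := J); linarith
    have hℓ0 : 0.69 ≤ ℓ := by linarith
    have hmain : 476 * Real.log (16 * n / δ) * √(ρ / (2 * ρ)) * (√(4 / 3) ^ J - 1)
        ≤ 476 * (4 * ℓ) * 1 * (2 * Z) := by
      have : 0 ≤ 476 * (4 * ℓ) := by linarith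
      gcongr
      linarith
    generalize hM : max (nnz C) n = M
    have hM1 : (1 : ℝ) ≤ M := by
      have : 1 ≤ M := by omega
      exact_mod_cast this
    have hnM : (n : ℝ) ≤ M := by
      have : n ≤ M := by omega
      exact_mod_cast this
    have hzM : (nnz C : ℝ) ≤ M := by
      have : nnz C ≤ M := by omega
      exact_mod_cast this
    have f1 : (1 : ℝ) ≤ 2 * ℓ := by linarith
    have f2 : Z ≤ Z * (2 * ℓ) := le_mul_of_one_le_right (by linarith) f1
    have f3 : ℓ ≤ Z * ℓ := le_mul_of_one_le_left (by linarith) hZ1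
    have f4 : Z * ℓ ≤ M * (Z * ℓ) := le_mul_of_one_le_left (by nlinarith) hM1
    have f5 : (M : ℝ) * 1 ≤ M * (2 * (Z * ℓ)) := by gcongr; linarith
    have f6 : (n : ℝ) * m ≤ M * (4 * (Z * ℓ)) := by gcongr; linarith
    have f7 : (M : ℝ) * (476 * Real.log (16 * n / δ) * √(ρ / (2 * ρ)) * (√(4 / 3) ^ J - 1)
        + 38 * J) ≤ M * (5000 * (Z * ℓ)) := by
      gcongr
      linarith
    push_cast
    linarith

/-- The polynomial filter is an approximate eigenvector oracle. -/
theorem isApproxMinEV_chebMinEV : IsApproxMinEV chebMinEV 6000 := by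
  intro n C ρ ε δ hn hC hρ hCρ hε hδ hδ1
  exact ⟨(failLE_iff hδ.le).1 (failLE_chebMinEV hn hC hρ hCρ hε hδ hδ1),
    stepsLE_chebMinEV hn hρ hCρ hε hδ hδ1⟩

/-! ### The bisection for a positive definite matrix of the pencil -/

/-- What is required of the result of PsdPencil: a positive definite matrix of the pencil, with an
approximation of its smallest eigenvalue. -/
def IsPsdResult (A B : Mat n) (ξ : ℝ) (r : Option (ℝ × ℝ × Vec n)) : Prop :=
  ∃ (μ lam : ℝ) (x : Vec n), r = some (μ, lam, x) ∧ 0 < μ ∧ μ ≤ 1 ∧ 3 * ξ / 4 ≤ lam ∧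
    lamMin (pencil A B μ) ≤ lam ∧ lam ≤ lamMin (pencil A B μ) + ξ / 4

/-- As long as all oracle calls succeed, the bisection interval contains the number `μ'` given by
the regularity assumption. Moreover, an unsuccessful midpoint has distance more than `ξ / (4 φ)`
from `μ'`, so the interval cannot become shorter than `ξ / (8 φ)`: the loop returns before its
steps are used up. -/
lemma failLE_psdLoop {O : Oracle} {c : ℝ} (hO : IsApproxMinEV O c) (hn : 0 < n) {A B : Mat n}
    (hA : A.IsSymm) (hB : B.IsSymm) {ξ φ δ' μ' : ℝ} (hξ : 0 < ξ) (hφ : 0 < φ)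
    (hAB : opNorm A + opNorm B ≤ φ) (hδ : 0 < δ') (hδ1 : δ' < 1)
    (hμ' : ∀ x : Vec n, ξ * ‖x‖ ^ 2 ≤ quad (pencil A B μ') x) (k : ℕ) (μ₁ μ₂ : ℝ)
    (h₁ : 0 ≤ μ₁) (h₂ : μ₂ ≤ 1) (h₁' : μ₁ < μ') (h₂' : μ' ≤ μ₂)
    (hw : ξ / (8 * φ) < μ₂ - μ₁) (hk : μ₂ - μ₁ ≤ 2 ^ k * (ξ / (8 * φ))) :
    (psdLoop O A B ξ φ δ' k μ₁ μ₂).FailLE (IsPsdResult A B ξ) (k * δ') := by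
  induction k generalizing μ₁ μ₂ with
  | zero => simp at hk; linarith
  | succ k ih =>
    rw [psdLoop, tick_eq_det]
    refine failLE_det_bind.2 ?_
    dsimp only
    rw [formPencil_eq]
    refine failLE_det_bind.2 ?_
    set μ := (μ₁ + μ₂) / 2 with hμ
    have hw0 : 0 < ξ / (8 * φ) := by positivity
    have hμ0 : 0 < μ := by rw [hμ]; linarith
    have hμ1 : μ ≤ 1 := by rw [hμ]; linarith
    have hC := isSymm_pencil hA hB μ
    rw [show ((k + 1 : ℕ) : ℝ) * δ' = δ' + k * δ' by push_cast; ring]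
    refine FailLE.bind (p := IsApproxPair (pencil A B μ) (ξ / 4))
      ((failLE_iff hδ.le).2 (hO n _ φ (ξ / 4) δ' hn hC hφ
        ((opNorm_pencil_le A B hμ0.le hμ1).trans hAB) (by positivity) hδ hδ1).1)
      hδ.le (by positivity) ?_
    rintro ⟨lam, x⟩ ⟨hx, hlam, hle⟩
    simp only at hx hlam hle ⊢
    have hmin := lamMin_le_quad hn hC hx
    by_cases hif : 3 * ξ / 4 ≤ lam
    · rw [if_pos hif]
      exact failLE_pure ⟨μ, lam, x, rfl, hμ0, hμ1, hif, by linarith, by linarith⟩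
    · rw [if_neg hif, evalQuad_eq]
      refine failLE_det_bind.2 ?_
      rw [evalQuad_eq]
      refine failLE_det_bind.2 ?_
      -- the form at `x` is affine along the pencil, with slope `D` of modulus at most `φ`
      have hD : |quad A x - quad B x| ≤ φ := by
        have hA' := abs_quad_le A x
        have hB' := abs_quad_le B x
        rw [hx] at hA' hB'
        have := abs_sub (quad A x) (quad B x)
        linarith
      have hgap : ξ / 4 < (μ' - μ) * (quad A x - quad B x) := by
        have h1 := hμ' x
        rw [hx, quad_pencil] at h1
        rw [quad_pencil] at hlam
        rw [not_le] at hif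
        linarith
      have h84 : ξ / (8 * φ) = ξ / 4 / φ / 2 := by field_simp; norm_num
      rw [pow_succ] at hk
      by_cases hs : quad B x < quad A x
      · rw [if_pos hs]
        have hlt : μ < μ' := by
          by_contra! hcon
          nlinarith
        have hfar : ξ / 4 / φ < μ' - μ := by
          rw [div_lt_iff₀ hφ]
          refine hgap.trans_le (mul_le_mul_of_nonneg_left ?_ (by linarith))
          exact (le_abs_self _).trans hD
        exact ih μ μ₂ hμ0.le h₂ hlt h₂' (by linarith) (by linarith)
      · rw [if_neg hs]
        rw [not_lt] at hs
        have hlt : μ' < μ := by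
          by_contra! hcon
          nlinarith
        have hfar : ξ / 4 / φ < μ - μ' := by
          rw [div_lt_iff₀ hφ]
          calc ξ / 4 < (μ - μ') * -(quad A x - quad B x) := by linarith
            _ ≤ (μ - μ') * φ := mul_le_mul_of_nonneg_left ((neg_le_abs _).trans hD) (by linarith)
        exact ih μ₁ μ h₁ hμ1 h₁' hlt.le (by linarith) (by linarith)

lemma failLE_psdPencil {O : Oracle} {c : ℝ} (hO : IsApproxMinEV O c) (hn : 0 < n) {A B : Mat n}
    (hA : A.IsSymm) (hB : B.IsSymm) {ξ φ δ μ' : ℝ} (hξ : 0 < ξ) (hφ : ξ < φ)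
    (hAB : opNorm A + opNorm B ≤ φ) (hδ : 0 < δ) (hδ1 : δ < 1)
    (hμ0 : 0 < μ') (hμ1 : μ' ≤ 1) (hμ' : ∀ x : Vec n, ξ * ‖x‖ ^ 2 ≤ quad (pencil A B μ') x) :
    (psdPencil O A B ξ φ δ).FailLE (IsPsdResult A B ξ) δ := by
  have hφ0 : 0 < φ := by linarith
  have h8 : 1 < 8 * φ / ξ := by rw [lt_div_iff₀ hξ]; linarith
  have hT : 0 < numIter ξ φ := Nat.ceil_pos.2 (Real.logb_pos one_lt_two h8)
  have hT1 : (1 : ℝ) ≤ numIter ξ φ := by exact_mod_cast hT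
  unfold psdPencil
  rw [tick_eq_det]
  refine failLE_det_bind.2 ?_
  have h := failLE_psdLoop hO hn hA hB hξ hφ0 hAB (δ' := δ / numIter ξ φ) (by positivity)
    ((div_le_self hδ.le hT1).trans_lt hδ1) hμ' (numIter ξ φ) 0 1 le_rfl le_rfl hμ0 hμ1
    (by rw [div_lt_iff₀ (by positivity)]; linarith)
    (by
      have h2 := le_pow_ceil_logb one_lt_two (by positivity : 0 < 8 * φ / ξ)
      rw [div_le_iff₀ hξ] at h2
      rw [← mul_div_assoc, le_div_iff₀ (by positivity), numIter]
      linarith)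
  rwa [mul_div_cancel₀ _ (by positivity)] at h

/-- The running time of the bisection, in terms of a bound `S` for one oracle call. -/
lemma stepsLE_psdLoop {O : Oracle} {A B : Mat n} {ξ φ δ' S N : ℝ} (hnN : (n : ℝ) ≤ N)
    (hN : (nnz A : ℝ) + nnz B ≤ N) (hN1 : 1 ≤ N)
    (hS : 0 ≤ S) (hOS : ∀ μ, 0 ≤ μ → μ ≤ 1 → (O n (pencil A B μ) φ (ξ / 4) δ').StepsLE S)
    (k : ℕ) (μ₁ μ₂ : ℝ) (h₁ : 0 ≤ μ₁) (h₂ : μ₂ ≤ 1) (h₁₂ : μ₁ ≤ μ₂) :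
    (psdLoop O A B ξ φ δ' k μ₁ μ₂).StepsLE (k * (22 * N + S)) := by
  have hpos : 0 ≤ 22 * N + S := by linarith
  have hA0 : (0 : ℝ) ≤ nnz A := by positivity
  have hB0 : (0 : ℝ) ≤ nnz B := by positivity
  have hn0 : (0 : ℝ) ≤ n := by positivity
  induction k generalizing μ₁ μ₂ with
  | zero => exact stepsLE_pure (by simp)
  | succ k ih =>
    have hk0 : 0 ≤ (k : ℝ) * (22 * N + S) := by positivity
    rw [psdLoop, tick_eq_det]
    refine stepsLE_det_bind ?_
    dsimp only
    rw [formPencil_eq]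
    refine stepsLE_det_bind ?_
    refine ((hOS ((μ₁ + μ₂) / 2) (by linarith) (by linarith)).bind (fun r => ?_)
      (t := 8 * N + k * (22 * N + S))).mono ?_
    · split_ifs with hif
      · exact stepsLE_pure (by linarith)
      · rw [evalQuad_eq]
        refine stepsLE_det_bind ?_
        rw [evalQuad_eq]
        refine stepsLE_det_bind ?_
        split_ifs with hs
        · refine (ih _ _ (by linarith) h₂ (by linarith)).mono ?_
          push_cast; linarith
        · refine (ih _ _ h₁ (by linarith) (by linarith)).mono ?_
          push_cast; linarith
    · push_cast; linarith

/-! ### Lower and upper bounds for the optimal value -/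

lemma Inst.Assumption.n_pos {P : Inst n} (hP : P.Assumption) : 0 < n := by
  rcases Nat.eq_zero_or_pos n with rfl | h
  · -- for `n = 0` the spectrum of `B` is empty, and its infimum is `0` by convention
    have h0 : lamMin P.B = 0 := by
      rw [lamMin, spectrum.of_subsingleton, Real.sInf_empty]
    have := hP.lamMinB
    have := hP.ξ_pos
    linarith
  · exact h

lemma Inst.Assumption.ξ_le_opNorm {P : Inst n} (hP : P.Assumption) : P.ξ ≤ opNorm P.B := by
  have h1 := (abs_le.1 (abs_lamMin_le hP.n_pos hP.symmB)).1
  have := hP.lamMinB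
  linarith

/-- All the norms in the data are bounded by `φ`. -/
lemma Inst.Assumption.φ_bounds {P : Inst n} (hP : P.Assumption) :
    opNorm P.A + opNorm P.B + ‖P.a‖ + ‖P.b‖ + |P.d| + 1 ≤ P.φ := by
  unfold Inst.φ
  linarith [hP.normA.1, hP.normB.1]

lemma Inst.Assumption.ξ_add_one_le_φ {P : Inst n} (hP : P.Assumption) : P.ξ + 1 ≤ P.φ := by
  linarith [hP.φ_bounds, hP.ξ_le_opNorm, opNorm_nonneg P.A, norm_nonneg P.a, norm_nonneg P.b,
    abs_nonneg P.d]

lemma Inst.Assumption.exists_regular {P : Inst n} (hP : P.Assumption) :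
    ∃ μ : ℝ, 0 < μ ∧ μ ≤ 1 ∧ ∀ x : Vec n, P.ξ * ‖x‖ ^ 2 ≤ quad (pencil P.A P.B μ) x := by
  obtain ⟨μ, h0, h1, h⟩ := hP.regular
  exact ⟨μ, h0, h1, (posSemidef_sub_smul_one_iff (isSymm_pencil hP.symmA hP.symmB μ) _).1 h⟩

/-- Regularity of the pencil puts a nonzero entry of `A` or `B` on each diagonal position. -/
lemma Inst.Assumption.n_le_N {P : Inst n} (hP : P.Assumption) : n ≤ P.N := by
  obtain ⟨μ, -, -, h⟩ := hP.exists_regular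
  refine (le_nnz_of_diag_ne_zero fun i => ?_).trans (nnz_pencil_le P.A P.B μ)
  have := h (EuclideanSpace.single i 1)
  rw [quad_single] at this
  simp only [EuclideanSpace.single, PiLp.norm_single, norm_one, one_pow, mul_one] at this
  exact (hP.ξ_pos.trans_le this).ne'

/-- A lower bound for the Lagrangian, by completing the square. -/
lemma dual_bound (P : Inst n) {μ lamBar : ℝ} (hμ : 0 < μ) (hl : 0 < lamBar)
    (h : ∀ x : Vec n, lamBar * ‖x‖ ^ 2 ≤ quad (pencil P.A P.B μ) x) (x : Vec n) :
    P.d * ((1 - μ) / μ) - μ * ‖P.a + ((1 - μ) / μ) • P.b‖ ^ 2 / lamBar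
      ≤ P.f x + (1 - μ) / μ * P.h x := by
  set ν := (1 - μ) / μ with hν
  set p := P.a + ν • P.b with hp
  have hμν : μ * ν = 1 - μ := by rw [hν]; field_simp
  have h1 := h x
  rw [quad_pencil, ← hμν] at h1
  have h2 : lamBar / μ * ‖x‖ ^ 2 ≤ quad P.A x + ν * quad P.B x := by
    rw [div_mul_eq_mul_div, div_le_iff₀ hμ]; linarith
  have h3 : inner ℝ p x = inner ℝ P.a x + ν * inner ℝ P.b x := by
    rw [hp, inner_add_left, real_inner_smul_left]
  have h4 : 0 ≤ lamBar / μ * (‖x‖ - μ / lamBar * ‖p‖) ^ 2 := by positivity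
  have h5 : lamBar / μ * (‖x‖ - μ / lamBar * ‖p‖) ^ 2
      = lamBar / μ * ‖x‖ ^ 2 - 2 * (‖p‖ * ‖x‖) + μ * ‖p‖ ^ 2 / lamBar := by
    field_simp
    ring
  have h6 := (abs_le.1 (abs_real_inner_le_norm p x)).1
  unfold Inst.f Inst.h
  linarith

lemma h_smul (P : Inst n) (α : ℝ) (y : Vec n) :
    P.h (α • y) = quad P.B y * α ^ 2 + 2 * inner ℝ P.b y * α + P.d := by
  unfold Inst.h
  rw [quad_smul_vec, inner_smul_right]
  ring

lemma f_smul (P : Inst n) (α : ℝ) (y : Vec n) :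
    P.f (α • y) = quad P.A y * α ^ 2 + 2 * inner ℝ P.a y * α := by
  unfold Inst.f
  rw [quad_smul_vec, inner_smul_right]
  ring

/-- The step length is a root of the quadratic equation if there is one, and otherwise it is `0`,
in which case the constant term is negative. -/
lemma stepLength_spec (root : Bool) {ϖ : ℝ} (hϖ : ϖ < 0) (β d : ℝ) :
    ϖ * stepLength root ϖ β d ^ 2 + 2 * β * stepLength root ϖ β d + d = 0 ∨
      stepLength root ϖ β d = 0 ∧ d < 0 := by
  by_cases h : 0 ≤ β ^ 2 - ϖ * d
  · left
    rw [stepLength, if_pos h]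
    have hs := Real.sq_sqrt h
    set s := √(β ^ 2 - ϖ * d)
    have hne := hϖ.ne
    have hr : (if root then (1 : ℝ) else -1) ^ 2 = 1 := by cases root <;> norm_num
    generalize (if root then (1 : ℝ) else -1) = r at hr
    field_simp
    linear_combination s ^ 2 * hr + hs
  · right
    refine ⟨by rw [stepLength, if_neg h], ?_⟩
    rw [not_le] at h
    by_contra! hd
    nlinarith [sq_nonneg β]

lemma h_stepLength_le (root : Bool) (P : Inst n) {y : Vec n} (hy : quad P.B y < 0) :
    P.h (stepLength root (quad P.B y) (inner ℝ P.b y) P.d • y) ≤ 0 := by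
  rw [h_smul]
  rcases stepLength_spec root hy (inner ℝ P.b y) P.d with h | ⟨h, hd⟩
  · exact h.le
  · rw [h]; simp [hd.le]

/-- Comparing the terms of the quadratic equation bounds the step length. -/
lemma abs_stepLength_le (root : Bool) {ϖ β d t φ : ℝ} (ht : 0 < t) (ht1 : t ≤ 1) (hφ : 1 ≤ φ)
    (hϖ : ϖ ≤ -(t / 2)) (hβ : |β| ≤ φ) (hd : |d| ≤ φ) :
    |stepLength root ϖ β d| ≤ 5 * (φ / t) := by
  rcases stepLength_spec root (ϖ := ϖ) (by linarith) β d with h | ⟨h, -⟩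
  · set α := stepLength root ϖ β d
    by_contra! hlt
    have hF : 1 ≤ φ / t := by rw [le_div_iff₀ ht]; linarith
    have h1 : t / 2 * |α| ^ 2 ≤ 2 * φ * |α| + φ := by
      have e1 : t / 2 * |α| ^ 2 ≤ -ϖ * |α| ^ 2 := by gcongr; linarith
      have e2 : 2 * β * α ≤ 2 * φ * |α| := by
        have := le_abs_self (β * α)
        rw [abs_mul] at this
        have := mul_le_mul_of_nonneg_right hβ (abs_nonneg α)
        linarith
      have e3 := le_abs_self d
      rw [sq_abs] at e1 ⊢
      linarith
    have h2 : 5 * φ * |α| ≤ t * |α| ^ 2 := by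
      have e1 : 5 * φ = t * (5 * (φ / t)) := by field_simp
      have e2 : t * (5 * (φ / t)) * |α| ≤ t * |α| * |α| := by gcongr
      rw [e1]; linarith
    have h3 : φ * 5 ≤ φ * |α| := by gcongr; linarith
    linarith
  · rw [h]; simp; positivity

lemma feasible_nonempty {P : Inst n} (hP : P.Assumption) : ∃ x, P.h x ≤ 0 := by
  obtain ⟨y, hy, hq⟩ := exists_quad_eq_lamMin hP.n_pos hP.symmB
  exact ⟨_, h_stepLength_le true P (hq ▸ hP.lamMinB.trans_lt (by linarith [hP.ξ_pos]))⟩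

/-- Weak duality. -/
lemma le_f_of_dual {P : Inst n} {l ν : ℝ} (hν : 0 ≤ ν) (hl : ∀ x, l ≤ P.f x + ν * P.h x) {x : Vec n}
    (hx : P.h x ≤ 0) : l ≤ P.f x := by
  have := hl x
  nlinarith

lemma exists_isOptimalValue {P : Inst n} (hP : P.Assumption) : ∃ v, P.IsOptimalValue v := by
  obtain ⟨x, hx⟩ := feasible_nonempty hP
  obtain ⟨μ, hμ, hμ1, h⟩ := hP.exists_regular
  have hbdd : BddBelow (P.f '' {x | P.h x ≤ 0}) := by
    refine ⟨P.d * ((1 - μ) / μ) - μ * ‖P.a + ((1 - μ) / μ) • P.b‖ ^ 2 / P.ξ, ?_⟩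
    rintro _ ⟨y, hy, rfl⟩
    exact le_f_of_dual (div_nonneg (by linarith) hμ.le) (dual_bound P hμ hP.ξ_pos h) hy
  exact Real.exists_isGLB ⟨_, x, hx, rfl⟩ hbdd

/-- If both randomized parts succeed, the output is correct. For the gap, `μ₀` is at least
`ξ / (2 φ)`, because the form of `B` is negative at a smallest eigenvector of `B`, and the step
length is at most `5 φ / ξ̃`. -/
lemma correct_of_success {P : Inst n} (hP : P.Assumption) {v : ℝ} (hv : P.IsOptimalValue v)
    (root : Bool) {μ lam : ℝ} {y : Vec n} (hμ : 0 < μ) (hμ1 : μ ≤ 1) (hlam : 3 * P.ξ / 4 ≤ lam)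
    (hlam1 : lamMin (pencil P.A P.B μ) ≤ lam) (hlam2 : lam ≤ lamMin (pencil P.A P.B μ) + P.ξ / 4)
    (hy : ‖y‖ = 1) (hyB : quad P.B y ≤ lamMin P.B + P.ξ / 2) :
    Output.Correct P v 41 ⟨μ, lam,
      P.d * ((1 - μ) / μ) - μ * ‖P.a + ((1 - μ) / μ) • P.b‖ ^ 2 / (lam - P.ξ / 4),
      P.f (stepLength root (quad P.B y) (inner ℝ P.b y) P.d • y)⟩ := by
  have hξ := hP.ξ_pos
  have hn := hP.n_pos
  have hC := isSymm_pencil hP.symmA hP.symmB μ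
  have hform : ∀ x : Vec n, (lam - P.ξ / 4) * ‖x‖ ^ 2 ≤ quad (pencil P.A P.B μ) x := fun x =>
    le_trans (by gcongr; linarith) (lamMin_mul_norm_sq_le hn hC x)
  have hlb : P.ξ / 2 ≤ lam - P.ξ / 4 := by linarith
  have hlb0 : 0 < lam - P.ξ / 4 := by linarith
  have hdual := dual_bound P hμ hlb0 hform
  have hϖ : quad P.B y ≤ -(P.ξ / 2) := by linarith [hP.lamMinB]
  have hfeas := h_stepLength_le root P (y := y) (by linarith)
  have hν : 0 ≤ (1 - μ) / μ := div_nonneg (by linarith) hμ.le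
  refine ⟨hμ, hμ1, ?_, hlam1, hlam2, hdual, ⟨_, y, hy, hyB, hfeas, rfl⟩, ?_, ?_, ?_⟩
  · rw [posSemidef_sub_smul_one_iff hC]
    exact fun x => le_trans (by gcongr) (hform x)
  · refine hv.2 ?_
    rintro _ ⟨x, hx, rfl⟩
    exact le_f_of_dual hν hdual hx
  · exact hv.1 ⟨_, hfeas, rfl⟩
  · have hφb := hP.φ_bounds
    have hA0 := opNorm_nonneg P.A
    have hB0 := opNorm_nonneg P.B
    have ha0 := norm_nonneg P.a
    have hb0 := norm_nonneg P.b
    have hd0 := abs_nonneg P.d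
    set t := P.ξt with ht
    have ht0 : 0 < t := lt_min hξ one_pos
    have htξ : t ≤ P.ξ := min_le_left _ _
    have ht1 : t ≤ 1 := min_le_right _ _
    have hφ1 : 1 ≤ P.φ := by linarith
    set F := P.φ / t with hF
    have hF1 : 1 ≤ F := by rw [hF, le_div_iff₀ ht0]; linarith
    have hinner : ∀ w : Vec n, |inner ℝ w y| ≤ ‖w‖ := fun w => by
      simpa [hy] using abs_real_inner_le_norm w y
    have hα := abs_stepLength_le root (ϖ := quad P.B y) (β := inner ℝ P.b y) (d := P.d) (φ := P.φ) ht0 ht1 hφ1 (by linarith)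
      ((hinner P.b).trans (by linarith)) (by linarith)
    rw [← hF] at hα
    have hFF : F ≤ F ^ 2 := by nlinarith
    -- the upper bound
    have hu : P.f (stepLength root (quad P.B y) (inner ℝ P.b y) P.d • y) ≤ P.φ * (35 * F ^ 2) := by
      rw [f_smul]
      generalize stepLength root (quad P.B y) (inner ℝ P.b y) P.d = α at *
      have hqA : quad P.A y ≤ P.φ := by
        have := (abs_le.1 (abs_quad_le P.A y)).2
        rw [hy] at this
        linarith
      have hα2 : α ^ 2 ≤ (5 * F) ^ 2 := by rw [← sq_abs]; gcongr
      have e1 : quad P.A y * α ^ 2 ≤ P.φ * (5 * F) ^ 2 := by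
        refine mul_le_mul hqA hα2 (sq_nonneg _) (by linarith)
      have e2 : inner ℝ P.a y * α ≤ P.φ * (5 * F) := by
        refine (le_abs_self _).trans ?_
        rw [abs_mul]
        exact mul_le_mul ((hinner P.a).trans (by linarith)) hα (abs_nonneg _) (by linarith)
      have e3 := mul_le_mul_of_nonneg_left hFF (by linarith : 0 ≤ P.φ)
      linarith
    -- the lower bound for `μ`
    have hμinv : 1 / μ ≤ 2 * F := by
      have h1 := hform y
      rw [hy, quad_pencil] at h1
      have h2 : (1 - μ) * quad P.B y ≤ 0 :=
        mul_nonpos_of_nonneg_of_nonpos (by linarith) (by linarith)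
      have h3 := (abs_le.1 (abs_quad_le P.A y)).2
      rw [hy] at h3
      have h4 : μ * quad P.A y ≤ μ * P.φ := by gcongr; linarith
      rw [hF, div_le_iff₀ hμ, show 2 * (P.φ / t) * μ = (2 * P.φ * μ) / t by ring,
        le_div_iff₀ ht0]
      linarith
    have hd : -(P.d * ((1 - μ) / μ)) ≤ P.φ * (2 * F ^ 2) := by
      have e1 : (1 - μ) / μ ≤ 2 * F := (by gcongr; linarith : (1 - μ) / μ ≤ 1 / μ).trans hμinv
      rw [← neg_mul]
      calc -P.d * ((1 - μ) / μ) ≤ P.φ * ((1 - μ) / μ) := by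
            gcongr; linarith [neg_le_abs P.d]
        _ ≤ P.φ * (2 * F) := by gcongr
        _ ≤ P.φ * (2 * F ^ 2) := by gcongr
    have hp : μ * ‖P.a + ((1 - μ) / μ) • P.b‖ ^ 2 / (lam - P.ξ / 4) ≤ P.φ * (4 * F ^ 2) := by
      have e1 : μ * ‖P.a + ((1 - μ) / μ) • P.b‖ ≤ P.φ := by
        have e2 : ‖P.a + ((1 - μ) / μ) • P.b‖ ≤ ‖P.a‖ + (1 - μ) / μ * ‖P.b‖ := by
          refine (norm_add_le _ _).trans ?_
          rw [norm_smul, Real.norm_of_nonneg hν]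
        refine (mul_le_mul_of_nonneg_left e2 hμ.le).trans ?_
        have e3 : μ * (‖P.a‖ + (1 - μ) / μ * ‖P.b‖) = μ * ‖P.a‖ + (1 - μ) * ‖P.b‖ := by
          field_simp
        rw [e3]
        nlinarith
      have e2 : 1 / (lam - P.ξ / 4) ≤ 2 / t := by
        rw [div_le_div_iff₀ hlb0 ht0]; linarith
      calc μ * ‖P.a + ((1 - μ) / μ) • P.b‖ ^ 2 / (lam - P.ξ / 4)
          = (μ * ‖P.a + ((1 - μ) / μ) • P.b‖) ^ 2 * (1 / μ) * (1 / (lam - P.ξ / 4)) := by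
            field_simp
        _ ≤ P.φ ^ 2 * (2 * F) * (2 / t) := by gcongr
        _ = P.φ * (4 * F ^ 2) := by rw [hF]; ring
    have hfin : 41 * P.φ ^ 3 / t ^ 2 = P.φ * (41 * F ^ 2) := by rw [hF]; ring
    rw [hfin]
    linarith

/-! ### The algorithm Bounds -/

lemma failLE_bounds {O : Oracle} {c : ℝ} (hO : IsApproxMinEV O c) (root : Bool) {P : Inst n}
    (hP : P.Assumption) {v δ : ℝ} (hv : P.IsOptimalValue v) (hδ : 0 < δ) (hδ1 : δ < 1) :
    (bounds O root P δ).FailLE (fun r => ∃ o, r = some o ∧ o.Correct P v 41) δ := by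
  have hφb := hP.φ_bounds
  have hξφ := hP.ξ_add_one_le_φ
  have hξ := hP.ξ_pos
  have hA0 := opNorm_nonneg P.A
  have ha0 := norm_nonneg P.a
  have hb0 := norm_nonneg P.b
  have hd0 := abs_nonneg P.d
  obtain ⟨μ', hμ0, hμ1, hμ'⟩ := hP.exists_regular
  refine Eq.mp (congrArg (FailLE _ _) (add_halves δ)) ?_
  unfold bounds
  refine FailLE.bind (failLE_psdPencil hO hP.n_pos hP.symmA hP.symmB hξ (by linarith)
    (by linarith) (by linarith) (by linarith) hμ0 hμ1 hμ') (by linarith) (by linarith) ?_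
  rintro _ ⟨μ, lam, x, rfl, h0, h1, hlam, hlam1, hlam2⟩
  dsimp only
  rw [tick_eq_det]; refine failLE_det_bind.2 ?_
  rw [lin_eq]; refine failLE_det_bind.2 ?_
  rw [dot_eq]; refine failLE_det_bind.2 ?_
  refine FailLE.bind_sure (p := IsApproxPair P.B (P.ξ / 2))
    ((failLE_iff (by linarith)).2 (hO n _ P.φ (P.ξ / 2) (δ / 2) hP.n_pos hP.symmB (by linarith)
      (by linarith) (by linarith) (by linarith) (by linarith)).1) (by linarith) ?_
  rintro ⟨ϖ, y⟩ ⟨hy, hϖ, hle⟩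
  simp only at hy hϖ hle ⊢
  rw [dot_eq]; refine failLE_det_bind.2 ?_
  rw [scale_eq]; refine failLE_det_bind.2 ?_
  rw [evalQuad_eq]; refine failLE_det_bind.2 ?_
  rw [dot_eq]; refine failLE_det_bind.2 ?_
  refine failLE_pure ⟨_, rfl, ?_⟩
  have h := correct_of_success hP hv root h0 h1 hlam hlam1 hlam2 hy hle
  rw [hϖ, real_inner_self_eq_norm_sq, one_smul]
  exact h

/-- The running time of Bounds, in terms of a bound `S` for one oracle call. -/
lemma stepsLE_bounds_of_oracle {O : Oracle} (root : Bool) {P : Inst n} {δ S : ℝ} (hnN : n ≤ P.N)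
    (hN0 : 0 < P.N) (hS0 : 0 ≤ S)
    (hpencil : ∀ μ, 0 ≤ μ → μ ≤ 1 →
      (O n (pencil P.A P.B μ) P.φ (P.ξ / 4) (δ / 2 / numIter P.ξ P.φ)).StepsLE S)
    (hB : (O n P.B P.φ (P.ξ / 2) (δ / 2)).StepsLE S) :
    (bounds O root P δ).StepsLE (numIter P.ξ P.φ + 5 + numIter P.ξ P.φ * (22 * P.N + S)
      + (50 + 15 * P.N + S)) := by
  have hNeq : (P.N : ℝ) = nnz P.A + nnz P.B := by rw [Inst.N]; push_cast; rfl
  have hnN' : (n : ℝ) ≤ P.N := by exact_mod_cast hnN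
  have hN1 : (1 : ℝ) ≤ P.N := by exact_mod_cast hN0
  have hB0 : (0 : ℝ) ≤ nnz P.B := Nat.cast_nonneg _
  have hpsd : (psdPencil O P.A P.B P.ξ P.φ (δ / 2)).StepsLE
      (numIter P.ξ P.φ + 5 + numIter P.ξ P.φ * (22 * P.N + S)) := by
    unfold psdPencil
    rw [tick_eq_det]
    refine stepsLE_det_bind ?_
    refine (stepsLE_psdLoop hnN' hNeq.ge hN1 hS0 hpencil _ 0 1 le_rfl le_rfl
      zero_le_one).mono ?_
    push_cast
    linarith
  unfold bounds
  refine hpsd.bind fun r => ?_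
  rcases r with _ | ⟨μ, lam, x⟩
  · exact stepsLE_pure (by positivity)
  · dsimp only
    rw [tick_eq_det]; refine stepsLE_det_bind ?_
    rw [lin_eq]; refine stepsLE_det_bind ?_
    rw [dot_eq]; refine stepsLE_det_bind ?_
    refine (hB.bind (fun e => ?_) (t := 10 * P.N)).mono (by push_cast; linarith)
    rw [dot_eq]; refine stepsLE_det_bind ?_
    rw [scale_eq]; refine stepsLE_det_bind ?_
    rw [evalQuad_eq]; refine stepsLE_det_bind ?_
    rw [dot_eq]; refine stepsLE_det_bind ?_
    refine stepsLE_pure ?_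
    push_cast
    linarith

/-- The running time of Bounds: at most `2 log (8 φ / ξ)` iterations, each dominated by one oracle
call. -/
lemma stepsLE_bounds {O : Oracle} {c : ℝ} (hO : IsApproxMinEV O c) (root : Bool) {P : Inst n}
    (hP : P.Assumption) {δ : ℝ} (hδ : 0 < δ) (hδ1 : δ < 1) :
    (bounds O root P δ).StepsLE ((232 + 24 * max c 0) * (P.N * √P.φ / √P.ξ
      * Real.log (n / δ * Real.log (8 * P.φ / P.ξ)) * Real.log (8 * P.φ / P.ξ))) := by
  have hφb := hP.φ_bounds
  have hξφ := hP.ξ_add_one_le_φ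
  have hξ := hP.ξ_pos
  have hφ0 : 0 < P.φ := by linarith
  have hA0 := opNorm_nonneg P.A
  have hB0 := opNorm_nonneg P.B
  have ha0 := norm_nonneg P.a
  have hb0 := norm_nonneg P.b
  have hd0 := abs_nonneg P.d
  have hn := hP.n_pos
  have hn1 : (1 : ℝ) ≤ n := by exact_mod_cast hn
  have hnN : (n : ℝ) ≤ P.N := by exact_mod_cast hP.n_le_N
  have hlog2 := Real.log_two_gt_d9
  have h8 : 8 ≤ 8 * P.φ / P.ξ := by rw [le_div_iff₀ hξ]; linarith
  set ℓ := Real.log (8 * P.φ / P.ξ) with hℓ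
  have hℓ2 : 3 * Real.log 2 ≤ ℓ := by
    rw [show 3 * Real.log 2 = Real.log (2 ^ 3) by rw [Real.log_pow]; norm_num]
    exact Real.log_le_log (by norm_num) (by linarith)
  have hℓ0 : 2 ≤ ℓ := by linarith
  set T := numIter P.ξ P.φ with hT
  have hT0 : 0 < T := Nat.ceil_pos.2 (Real.logb_pos one_lt_two (by linarith))
  have hT1 : (1 : ℝ) ≤ T := by exact_mod_cast hT0
  have hTℓ : (T : ℝ) ≤ 2 * ℓ := by
    have h1 := (Nat.ceil_lt_add_one (Real.logb_nonneg one_lt_two (by linarith : 1 ≤ 8 * P.φ / P.ξ))).le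
    have h2 : Real.logb 2 (8 * P.φ / P.ξ) ≤ 3 / 2 * ℓ := by
      rw [Real.logb, div_le_iff₀ (by linarith)]
      nlinarith
    rw [hT, numIter]
    linarith
  set R := √P.φ / √P.ξ with hR
  have hRdiv : R = √(P.φ / P.ξ) := (Real.sqrt_div hφ0.le _).symm
  have hR1 : 1 ≤ R := by
    rw [hRdiv, Real.one_le_sqrt, le_div_iff₀ hξ]; linarith
  set Λ := Real.log (n / δ * ℓ) with hΛ
  have hnδ : 1 ≤ n / δ := by rw [le_div_iff₀ hδ]; linarith
  have hΛ0 : Real.log 2 ≤ Λ := Real.log_le_log (by norm_num) (by nlinarith)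
  -- a common bound for the oracle calls
  set S := 8 * max c 0 * (P.N * R * Λ) with hS
  have hS0 : 0 ≤ S := by
    have : 0 ≤ Λ := by linarith
    positivity
  have hoc : ∀ (C : Mat n) (q δ' : ℝ), C.IsSymm → opNorm C ≤ P.φ → nnz C ≤ P.N → 1 / 4 ≤ q →
      0 < δ' → δ' < 1 → δ ≤ 2 * T * δ' → (O n C P.φ (P.ξ * q) δ').StepsLE S := by
    intro C q δ' hC hCφ hCN hq hδ' hδ'1 hδT
    refine (hO n C P.φ (P.ξ * q) δ' hn hC hφ0 hCφ (by positivity) hδ' hδ'1).2.mono ?_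
    have e1 : max 1 √(P.φ / (P.ξ * q)) ≤ 2 * R := by
      refine max_le (by linarith) ?_
      rw [hRdiv]
      refine Real.sqrt_le_iff.2 ⟨by positivity, ?_⟩
      rw [mul_pow, Real.sq_sqrt (by positivity), ← div_div, div_le_iff₀ (by linarith)]
      have : 0 ≤ P.φ / P.ξ := by positivity
      nlinarith
    have e2 : Real.log (2 * n / δ') ≤ 4 * Λ := by
      have e3 : 2 * n / δ' ≤ 2 ^ 3 * (n / δ * ℓ) := by
        rw [div_le_iff₀ hδ']
        have : (2 : ℝ) * n = 2 * (n / δ) * δ := by field_simp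
        rw [this]
        have e4 : 2 * (n / δ) * δ ≤ 2 * (n / δ) * (2 * T * δ') := by gcongr
        have e5 : 2 * (n / δ) * (2 * T * δ') ≤ 2 * (n / δ) * (2 * (2 * ℓ) * δ') := by gcongr
        linarith
      have e6 := Real.log_le_log (by positivity) e3
      rw [Real.log_mul (by norm_num) (by positivity), Real.log_pow] at e6
      push_cast at e6
      linarith
    have e3 : 0 ≤ Real.log (2 * n / δ') := by
      refine Real.log_nonneg ?_
      rw [le_div_iff₀ hδ']; linarith
    have e4 : ((max (nnz C) n : ℕ) : ℝ) ≤ P.N := by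
      exact_mod_cast max_le hCN hP.n_le_N
    calc c * (max (nnz C) n : ℕ) * max 1 √(P.φ / (P.ξ * q)) * Real.log (2 * n / δ')
        ≤ max c 0 * P.N * (2 * R) * (4 * Λ) := by
          have := le_max_left c 0
          gcongr
      _ = S := by rw [hS]; ring
  have hrest := stepsLE_bounds_of_oracle (O := O) root (P := P) (δ := δ) hP.n_le_N
    (hn.trans_le hP.n_le_N) hS0
    (fun μ h0 h1 => by
      rw [div_eq_mul_one_div P.ξ 4]
      refine hoc _ _ _ (isSymm_pencil hP.symmA hP.symmB μ)
        ((opNorm_pencil_le _ _ h0 h1).trans (by linarith)) (nnz_pencil_le _ _ _) le_rfl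
        (by positivity) ((div_le_self (by linarith) hT1).trans_lt (by linarith)) ?_
      rw [← hT]
      field_simp
      exact le_rfl)
    (by
      rw [div_eq_mul_one_div P.ξ 2]
      exact hoc _ _ _ hP.symmB (by linarith) (Nat.le_add_left _ _) (by norm_num) (by linarith)
        (by linarith) (by nlinarith))
  rw [← hT] at hrest
  refine hrest.mono ?_
  have hN1 : (1 : ℝ) ≤ P.N := by linarith
  have hℓN : ℓ ≤ P.N * ℓ := le_mul_of_one_le_left (by linarith) hN1
  have f1 : T * (22 * P.N + S) ≤ 2 * ℓ * (22 * P.N + S) := by gcongr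
  have f2 : S ≤ S * ℓ := le_mul_of_one_le_right hS0 (by linarith)
  have f3 : (P.N : ℝ) ≤ P.N * ℓ := le_mul_of_one_le_right (by linarith) (by linarith)
  have f4 : P.N * ℓ ≤ P.N * ℓ * (R * (2 * Λ)) := by
    refine le_mul_of_one_le_right (by positivity) ?_
    nlinarith
  have f5 : (232 + 24 * max c 0) * (P.N * √P.φ / √P.ξ * Λ * ℓ)
      = 116 * (P.N * ℓ * (R * (2 * Λ))) + 3 * (S * ℓ) := by
    rw [hS, hR]; ring
  rw [f5]
  linarith

/-- If `φ` is at most a fixed power of `1/ξ`, then `log (8 φ / ξ)` may be replaced by `log (1/ξ)`. -/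
lemma log_factors_le {ν ξ φ κ : ℝ} (hν : 1 ≤ ν) (hξ : 0 < ξ) (hξ4 : ξ ≤ 1 / 4) (hφ : 1 ≤ φ)
    (hκ : φ ≤ (1 / ξ) ^ κ) :
    Real.log (ν * Real.log (8 * φ / ξ)) * Real.log (8 * φ / ξ) ≤
      (3 + |κ|) * (1 + 4 * Real.log (3 + |κ|)) *
        (Real.log (ν * Real.log (1 / ξ)) * Real.log (1 / ξ)) := by
  have hlog2 := Real.log_two_gt_d9
  have hξinv : 4 ≤ 1 / ξ := by rw [le_div_iff₀ hξ]; linarith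
  set ℓ := Real.log (1 / ξ) with hℓ
  have hℓ4 : 2 * Real.log 2 ≤ ℓ := by
    rw [show 2 * Real.log 2 = Real.log (2 ^ 2) by rw [Real.log_pow]; norm_num]
    exact Real.log_le_log (by norm_num) (by linarith)
  have hκ0 := abs_nonneg κ
  have hlogC : 0 ≤ Real.log (3 + |κ|) := Real.log_nonneg (by linarith)
  have h1 : Real.log (8 * φ / ξ) ≤ (3 + |κ|) * ℓ := by
    have e1 : Real.log φ ≤ κ * ℓ := by
      have := Real.log_le_log (by linarith) hκ
      rwa [Real.log_rpow (by positivity)] at this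
    have e2 : κ * ℓ ≤ |κ| * ℓ := mul_le_mul_of_nonneg_right (le_abs_self κ) (by linarith)
    have e3 : Real.log (8 * φ / ξ) = 3 * Real.log 2 + Real.log φ + ℓ := by
      rw [show 8 * φ / ξ = 2 ^ 3 * φ * (1 / ξ) by ring, Real.log_mul (by positivity)
        (by positivity), Real.log_mul (by norm_num) (by positivity), Real.log_pow]
      push_cast
      rfl
    rw [e3]
    linarith
  have h0 : 0 < Real.log (8 * φ / ξ) := by
    refine Real.log_pos ?_
    rw [lt_div_iff₀ hξ]; linarith
  have hΛ : 1 / 4 ≤ Real.log (ν * ℓ) := by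
    have e1 := Real.one_sub_inv_le_log_of_pos (by linarith : 0 < ℓ)
    have e2 : ℓ⁻¹ ≤ 3 / 4 := by
      rw [inv_le_comm₀ (by linarith) (by norm_num)]; linarith
    have e3 : Real.log ℓ ≤ Real.log (ν * ℓ) :=
      Real.log_le_log (by linarith) (le_mul_of_one_le_left (by linarith) hν)
    linarith
  have h2 : Real.log (ν * Real.log (8 * φ / ξ)) ≤ (1 + 4 * Real.log (3 + |κ|)) * Real.log (ν * ℓ) := by
    calc Real.log (ν * Real.log (8 * φ / ξ)) ≤ Real.log ((3 + |κ|) * (ν * ℓ)) := by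
          refine Real.log_le_log (by positivity) ?_
          have := mul_le_mul_of_nonneg_left h1 (by linarith : 0 ≤ ν)
          linarith
      _ = Real.log (3 + |κ|) + Real.log (ν * ℓ) :=
          Real.log_mul (by positivity) (mul_pos (by linarith) (by linarith)).ne'
      _ ≤ _ := by nlinarith
  calc _ ≤ (1 + 4 * Real.log (3 + |κ|)) * Real.log (ν * ℓ) * ((3 + |κ|) * ℓ) := by
        refine mul_le_mul h2 h1 h0.le ?_
        have : 0 ≤ Real.log (ν * ℓ) := by linarith
        positivity
    _ = _ := by ring

end

end GTRS

theorem mainTheorem4 :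
    -- an approximate eigenvector oracle exists
    (∃ c : ℝ, GTRS.IsApproxMinEV GTRS.chebMinEV c) ∧
    -- Bounds, run with any such oracle
    ∃ K : ℝ, ∀ c : ℝ, ∃ (K₁ : ℝ) (K₂ : ℝ → ℝ),
      ∀ O : GTRS.Oracle, GTRS.IsApproxMinEV O c →
      ∀ (root : Bool) (n : ℕ) (P : GTRS.Inst n) (δ : ℝ), P.Assumption → 0 < δ → δ < 1 →
        (∃ v : ℝ, P.IsOptimalValue v ∧
          ENNReal.ofReal (1 - δ) ≤
            (GTRS.bounds O root P δ).prob (fun r => ∃ o, r = some o ∧ o.Correct P v K)) ∧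
        (GTRS.bounds O root P δ).StepsLE
          (K₁ * (P.N * Real.sqrt P.φ / Real.sqrt P.ξ
            * Real.log (n / δ * Real.log (8 * P.φ / P.ξ)) * Real.log (8 * P.φ / P.ξ))) ∧
        ∀ κ : ℝ, P.ξ ≤ 1 / 4 → P.φ ≤ (1 / P.ξ) ^ κ →
          (GTRS.bounds O root P δ).StepsLE
            (K₂ κ * (P.N * Real.sqrt P.φ / Real.sqrt P.ξ
              * Real.log (n / δ * Real.log (1 / P.ξ)) * Real.log (1 / P.ξ))) := by
  refine ⟨⟨6000, GTRS.isApproxMinEV_chebMinEV⟩, 41, fun c => ⟨232 + 24 * max c 0, fun κ =>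
    (232 + 24 * max c 0) * ((3 + |κ|) * (1 + 4 * Real.log (3 + |κ|))), ?_⟩⟩
  intro O hO root n P δ hP hδ hδ1
  have hsteps := GTRS.stepsLE_bounds hO root hP hδ hδ1
  refine ⟨?_, hsteps, fun κ hξ4 hκ => hsteps.mono ?_⟩
  · obtain ⟨v, hv⟩ := GTRS.exists_isOptimalValue hP
    exact ⟨v, hv, (GTRS.Alg.failLE_iff hδ.le).1 (GTRS.failLE_bounds hO root hP hv hδ hδ1)⟩
  · have hn1 : (1 : ℝ) ≤ n := by exact_mod_cast hP.n_pos
    have h := GTRS.log_factors_le (ν := n / δ) (by rw [le_div_iff₀ hδ]; linarith) hP.ξ_pos hξ4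
      (by linarith [hP.ξ_add_one_le_φ, hP.ξ_pos]) hκ
    have hpos : 0 ≤ (232 + 24 * max c 0) * (P.N * √P.φ / √P.ξ) := by positivity
    have h2 := mul_le_mul_of_nonneg_left h hpos
    linarith
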